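/- Let $G$ be a compact Hausdorff topological group with dual object $\widehat G$ (the set of equivalence classes of irreducible unitary representations), $d_\pi$ the degree of $\pi\in\widehat G$, and let $E$ be a (complete, complex) operator space. For $d\ge 1$ let $S_d^1=(M_d)^\star$ be the space of complex $d\times d$ matrices with the operator space structure given by the trace duality $\langle A,B\rangle=\mathrm{tr}(AB)$ with $M_d=\mathcal B(\ell^2(d))$, and let $S_d^1(E)=S_d^1\otimes^\wedge E$, regarded as the space of $d\times d$ matrices over $E$, where $\otimes^\wedge$ denotes the (completed) operator space projective tensor product. Let $$\mathcal L^1_E(\widehat G)=\Big\{A\in\prod_{\pi\in\widehat G}M_{d_\pi}\otimes E:\ \|A\|=\sum_{\pi\in\widehat G}d_\pi\|A^\pi\|_{S^1_{d_\pi}(E)}<\infty\Big\},$$ with its natural operator space structure as a weighted $\ell^1$-sum: the norm of $(A_{kl})\in M_n(\mathcal L^1_E(\widehat G))$ is the supremum of $\big\|\big(\sum_\pi d_\pi\,\varphi_\pi(A_{kl}^\pi)\big)_{kl}\big\|_{M_n(M_m)}$ over all $m\ge 1$ and all families of complete contractions $\varphi_\pi:S^1_{d_\pi}(E)\to M_m$.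 Write $\mathcal L^1(\widehat G)=\mathcal L^1_{\mathbb C}(\widehat G)$. Then the identity map $$\mathcal L^1(\widehat G)\otimes^\wedge E\longrightarrow \mathcal L^1_E(\widehat G),$$ that is, the map determined by $A\otimes e\mapsto (A^\pi\otimes e)_{\pi\in\widehat G}$, is (well defined and) a complete isometry: for every $n\ge1$ the map it induces between the spaces of $n\times n$ matrices is isometric. -/

import Mathlib

namespace OpSp

/-- The norm of a rectangular complex matrix as an operator between Euclidean spaces. -/
noncomputable def opNorm {m n : Type*} [Fintype m] [Fintype n] [DecidableEq n]
    (A : Matrix m n ℂ) : ℝ :=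
  ‖LinearMap.toContinuousLinearMap (Matrix.toEuclideanLin A)‖

section opNorm

set_option linter.unusedSectionVars false

variable {l m n o : Type*} [Fintype l] [Fintype m] [Fintype n] [Fintype o]
  [DecidableEq l] [DecidableEq m] [DecidableEq n] [DecidableEq o]

theorem opNorm_nonneg (A : Matrix m n ℂ) : 0 ≤ opNorm A := norm_nonneg _

theorem sum_mulVec_le (A : Matrix m n ℂ) (x : n → ℂ) :
    ∑ i, ‖∑ j, A i j * x j‖ ^ 2 ≤ opNorm A ^ 2 * ∑ j, ‖x j‖ ^ 2 := by
  have h := (LinearMap.toContinuousLinearMap (Matrix.toEuclideanLin A)).le_opNorm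
    (WithLp.toLp 2 x)
  have h2 := pow_le_pow_left₀ (norm_nonneg _) h 2
  rw [mul_pow, EuclideanSpace.norm_sq_eq, EuclideanSpace.norm_sq_eq] at h2
  simpa [Matrix.toLpLin_apply, Matrix.mulVec, dotProduct, opNorm] using h2

theorem opNorm_le {A : Matrix m n ℂ} {C : ℝ} (hC : 0 ≤ C)
    (h : ∀ x : n → ℂ, ∑ i, ‖∑ j, A i j * x j‖ ^ 2 ≤ C ^ 2 * ∑ j, ‖x j‖ ^ 2) :
    opNorm A ≤ C := by
  refine ContinuousLinearMap.opNorm_le_bound _ hC fun x => ?_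
  refine le_of_sq_le_sq ?_ (mul_nonneg hC (norm_nonneg _))
  rw [mul_pow, EuclideanSpace.norm_sq_eq, EuclideanSpace.norm_sq_eq]
  simpa [Matrix.toLpLin_apply, Matrix.mulVec, dotProduct] using h x.ofLp

theorem opNorm_mul (A : Matrix l m ℂ) (B : Matrix m n ℂ) :
    opNorm (A * B) ≤ opNorm A * opNorm B := by
  refine opNorm_le (mul_nonneg (opNorm_nonneg _) (opNorm_nonneg _)) fun x => ?_
  have h1 := sum_mulVec_le A (fun i => ∑ j, B i j * x j)
  have h2 := mul_le_mul_of_nonneg_left (sum_mulVec_le B x) (sq_nonneg (opNorm A))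
  have e : ∀ i, ∑ j, (A * B) i j * x j = ∑ k, A i k * ∑ j, B k j * x j := fun i => by
    simp only [Matrix.mul_apply, Finset.sum_mul, Finset.mul_sum]
    rw [Finset.sum_comm]
    simp only [mul_assoc]
  simp only [e]
  nlinarith

theorem opNorm_smul (c : ℂ) (A : Matrix m n ℂ) : opNorm (c • A) = ‖c‖ * opNorm A := by
  simp [opNorm, norm_smul]

theorem opNorm_add_le (A B : Matrix m n ℂ) : opNorm (A + B) ≤ opNorm A + opNorm B := by
  simpa [opNorm] using norm_add_le (LinearMap.toContinuousLinearMap (Matrix.toEuclideanLin A))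
    (LinearMap.toContinuousLinearMap (Matrix.toEuclideanLin B))

theorem opNorm_zero : opNorm (0 : Matrix m n ℂ) = 0 := by simp [opNorm]

theorem opNorm_sum_le {ι : Type*} (s : Finset ι) (A : ι → Matrix m n ℂ) :
    opNorm (∑ i ∈ s, A i) ≤ ∑ i ∈ s, opNorm (A i) := by
  classical
  induction s using Finset.induction_on with
  | empty => simp [opNorm_zero]
  | insert a s ha ih =>
    rw [Finset.sum_insert ha, Finset.sum_insert ha]
    exact (opNorm_add_le _ _).trans (by linarith)

theorem norm_entry_le (A : Matrix m n ℂ) (i : m) (j : n) : ‖A i j‖ ≤ opNorm A := by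
  have h := sum_mulVec_le A (Pi.single j 1)
  have e : ∀ i, ∑ k, A i k * (Pi.single j 1 : n → ℂ) k = A i j := fun i => by
    simp [Pi.single_apply]
  have e2 : ∑ k, ‖(Pi.single j 1 : n → ℂ) k‖ ^ 2 = 1 := by
    rw [Finset.sum_eq_single j] <;> simp +contextual
  simp only [e, e2, mul_one] at h
  refine le_of_sq_le_sq ((Finset.single_le_sum (f := fun i => ‖A i j‖ ^ 2)
    (fun _ _ => sq_nonneg _) (Finset.mem_univ i)).trans h) (opNorm_nonneg _)

theorem opNorm_one_le : opNorm (1 : Matrix n n ℂ) ≤ 1 := by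
  refine opNorm_le zero_le_one fun x => ?_
  simp [Matrix.one_apply]

/-- The ampliation `A ⊗ 1`. -/
theorem opNorm_kron_one_le (A : Matrix m n ℂ) :
    opNorm (Matrix.of fun (i : m × o) (j : n × o) => if i.2 = j.2 then A i.1 j.1 else 0)
      ≤ opNorm A := by
  refine opNorm_le (opNorm_nonneg _) fun x => ?_
  rw [Fintype.sum_prod_type_right, Fintype.sum_prod_type_right, Finset.mul_sum]
  refine Finset.sum_le_sum fun b _ => ?_
  have := sum_mulVec_le A (fun j => x (j, b))
  simpa [Fintype.sum_prod_type, ite_mul] using this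

/-- A matrix which is `A` on the ranges of two injections and vanishes elsewhere. -/
theorem opNorm_pad_le (A : Matrix m n ℂ) (C : Matrix l o ℂ) {f : m → l} {g : n → o}
    (hf : f.Injective) (hg : g.Injective) (hA : ∀ i j, A i j = C (f i) (g j))
    (hf0 : ∀ i ∉ Set.range f, ∀ j, C i j = 0) (hg0 : ∀ j ∉ Set.range g, ∀ i, C i j = 0) :
    opNorm C ≤ opNorm A := by
  refine opNorm_le (opNorm_nonneg _) fun x => ?_
  have h := sum_mulVec_le A (x ∘ g)
  have e1 : ∀ i, ∑ j, A i j * (x ∘ g) j = ∑ j, C (f i) j * x j := fun i =>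
    Fintype.sum_of_injective g hg _ _ (fun j hj => by simp [hg0 j hj])
      (fun j => by simp [hA])
  have e2 : ∑ i, ‖∑ j, A i j * (x ∘ g) j‖ ^ 2 = ∑ i, ‖∑ j, C i j * x j‖ ^ 2 :=
    Fintype.sum_of_injective f hf _ _ (fun i hi => by simp [hf0 i hi])
      (fun i => by rw [e1])
  have e3 : ∑ j, ‖(x ∘ g) j‖ ^ 2 ≤ ∑ j, ‖x j‖ ^ 2 := by
    have := Finset.sum_le_sum_of_subset_of_nonneg (Finset.subset_univ (Finset.univ.map ⟨g, hg⟩))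
      (f := fun j => ‖x j‖ ^ 2) (fun _ _ _ => sq_nonneg _)
    simpa using this
  rw [e2] at h
  exact h.trans (mul_le_mul_of_nonneg_left e3 (sq_nonneg _))

theorem opNorm_fromBlocks_le (A : Matrix m n ℂ) (B : Matrix l o ℂ) :
    opNorm (Matrix.fromBlocks A 0 0 B) ≤ max (opNorm A) (opNorm B) := by
  refine opNorm_le (le_max_of_le_left (opNorm_nonneg _)) fun x => ?_
  rw [Fintype.sum_sum_type, Fintype.sum_sum_type, mul_add]
  refine add_le_add ?_ ?_
  · refine le_trans ?_ (mul_le_mul_of_nonneg_right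
      (pow_le_pow_left₀ (opNorm_nonneg A) (le_max_left _ (opNorm B)) 2) (by positivity))
    simpa using sum_mulVec_le A (fun j => x (Sum.inl j))
  · refine le_trans ?_ (mul_le_mul_of_nonneg_right
      (pow_le_pow_left₀ (opNorm_nonneg B) (le_max_right (opNorm A) _) 2) (by positivity))
    simpa using sum_mulVec_le B (fun j => x (Sum.inr j))

end opNorm

/-- The block diagonal matrix `x ⊕ y`. -/
def dsum {V : Type*} [Zero V] {m m' n n' : ℕ} (x : Matrix (Fin m) (Fin m') V)
    (y : Matrix (Fin n) (Fin n') V) : Matrix (Fin (m + n)) (Fin (m' + n')) V :=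
  (Matrix.fromBlocks x 0 0 y).submatrix finSumFinEquiv.symm finSumFinEquiv.symm

section dsum

variable {V : Type*} [Zero V] {m m' n n' : ℕ} (x : Matrix (Fin m) (Fin m') V)
    (y : Matrix (Fin n) (Fin n') V)

@[simp] theorem dsum_ll (i : Fin m) (j : Fin m') :
    dsum x y (Fin.castAdd n i) (Fin.castAdd n' j) = x i j := by simp [dsum]
@[simp] theorem dsum_lr (i : Fin m) (j : Fin n') :
    dsum x y (Fin.castAdd n i) (Fin.natAdd m' j) = 0 := by simp [dsum]
@[simp] theorem dsum_rl (i : Fin n) (j : Fin m') :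
    dsum x y (Fin.natAdd m i) (Fin.castAdd n' j) = 0 := by simp [dsum]
@[simp] theorem dsum_rr (i : Fin n) (j : Fin n') :
    dsum x y (Fin.natAdd m i) (Fin.natAdd m' j) = y i j := by simp [dsum]

end dsum

theorem opNorm_dsum_le {m m' n n' : ℕ} (A : Matrix (Fin m) (Fin m') ℂ)
    (B : Matrix (Fin n) (Fin n') ℂ) : opNorm (dsum A B) ≤ max (opNorm A) (opNorm B) := by
  refine le_trans (opNorm_pad_le (Matrix.fromBlocks A 0 0 B) _
    finSumFinEquiv.injective finSumFinEquiv.injective ?_ ?_ ?_) (opNorm_fromBlocks_le A B)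
  · intro i j; simp [dsum]
  · intro i hi; exact absurd (finSumFinEquiv.surjective i) hi
  · intro i hi; exact absurd (finSumFinEquiv.surjective i) hi

/-- The product `α v β` of a matrix `v` over a complex vector space with scalar matrices. -/
noncomputable def bimod {V : Type*} [AddCommGroup V] [Module ℂ V] {m n k l : Type*} [Fintype k] [Fintype l]
    (α : Matrix m k ℂ) (v : Matrix k l V) (β : Matrix l n ℂ) : Matrix m n V :=
  fun i j => ∑ a, ∑ b, (α i a * β b j) • v a b

section bimod

variable {V : Type*} [AddCommGroup V] [Module ℂ V]
  {m n k l k' l' : Type*} [Fintype k] [Fintype l] [Fintype k'] [Fintype l']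

theorem bimod_bimod (γ : Matrix m k' ℂ) (α : Matrix k' k ℂ) (v : Matrix k l V)
    (β : Matrix l l' ℂ) (δ : Matrix l' n ℂ) :
    bimod γ (bimod α v β) δ = bimod (γ * α) v (β * δ) := by
  ext i j
  simp only [bimod, Matrix.mul_apply, Finset.smul_sum, smul_smul, Finset.sum_mul_sum,
    Finset.sum_smul]
  rw [show ∑ a : k', ∑ b : l', ∑ c : k, ∑ d : l, (γ i a * δ b j * (α a c * β d b)) • v c d
    = ∑ a : k', ∑ c : k, ∑ d : l, ∑ b : l', (γ i a * δ b j * (α a c * β d b)) • v c d from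
      Finset.sum_congr rfl fun a _ => by
        rw [Finset.sum_comm]
        exact Finset.sum_congr rfl fun c _ => Finset.sum_comm]
  rw [Finset.sum_comm]
  refine Finset.sum_congr rfl fun c _ => ?_
  rw [Finset.sum_comm]
  refine Finset.sum_congr rfl fun d _ => Finset.sum_congr rfl fun a _ =>
    Finset.sum_congr rfl fun b _ => ?_
  congr 1; ring

theorem bimod_eq_mul [DecidableEq k] [DecidableEq l] (α : Matrix m k ℂ) (v : Matrix k l ℂ)
    (β : Matrix l n ℂ) : bimod α v β = α * v * β := by
  ext i j
  simp only [bimod, Matrix.mul_apply, Finset.sum_mul, smul_eq_mul]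
  rw [Finset.sum_comm]
  exact Finset.sum_congr rfl fun _ _ => Finset.sum_congr rfl fun _ _ => by ring

theorem bimod_map {W : Type*} [AddCommGroup W] [Module ℂ W] (f : V →ₗ[ℂ] W) (α : Matrix m k ℂ)
    (v : Matrix k l V) (β : Matrix l n ℂ) : (bimod α v β).map f = bimod α (v.map f) β := by
  ext i j; simp [bimod]

theorem bimod_smul_one [DecidableEq k] (c : ℂ) (v : Matrix k k V) :
    bimod (c • 1) v 1 = c • v := by
  ext i j
  simp [bimod, Matrix.one_apply, Finset.sum_ite_eq]

end bimod

theorem dsum_map {V W : Type*} [AddCommGroup V] [Module ℂ V] [AddCommGroup W] [Module ℂ W]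
    {m n : ℕ} (f : V →ₗ[ℂ] W) (x : Matrix (Fin m) (Fin m) V) (y : Matrix (Fin n) (Fin n) V) :
    (dsum x y).map f = dsum (x.map f) (y.map f) := by
  ext i j
  refine Fin.addCases (fun i => ?_) (fun i => ?_) i <;>
  refine Fin.addCases (fun j => ?_) (fun j => ?_) j <;> simp

/-- Matrix seminorms on a complex vector space satisfying Ruan's conditions
`‖x ⊕ y‖ ≤ max ‖x‖ ‖y‖` (the reverse inequality follows from the next condition)
and `‖α x β‖ ≤ ‖α‖ ‖x‖ ‖β‖`. -/
class PreOperatorSpace (V : Type*) [AddCommGroup V] [Module ℂ V] where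
  mnorm : ∀ n : ℕ, Seminorm ℂ (Matrix (Fin n) (Fin n) V)
  mnorm_dsum_le : ∀ {m n : ℕ} (x : Matrix (Fin m) (Fin m) V) (y : Matrix (Fin n) (Fin n) V),
    mnorm (m + n) (dsum x y) ≤ max (mnorm m x) (mnorm n y)
  mnorm_bimod_le : ∀ {m n : ℕ} (α : Matrix (Fin n) (Fin m) ℂ) (x : Matrix (Fin m) (Fin m) V)
    (β : Matrix (Fin m) (Fin n) ℂ),
    mnorm n (bimod α x β) ≤ opNorm α * mnorm m x * opNorm β

/-- The seminorm of a vector, that is, of the corresponding `1 × 1` matrix. -/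
noncomputable def vnorm {V : Type*} [AddCommGroup V] [Module ℂ V] [PreOperatorSpace V] (x : V) : ℝ :=
  PreOperatorSpace.mnorm 1 (Matrix.of fun _ _ => x)

/-- An operator space: the matrix seminorms are norms and the space is complete.  (It suffices
to ask for this on `1 × 1` matrices, since
`‖x i j‖ ≤ ‖x‖ ≤ ∑ i, ∑ j, ‖x i j‖` by the conditions above.) -/
class OperatorSpace (V : Type*) [AddCommGroup V] [Module ℂ V] extends PreOperatorSpace V where
  eq_zero_of_vnorm : ∀ x : V, vnorm x = 0 → x = 0
  complete : ∀ u : ℕ → V,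
    (∀ ε > 0, ∃ N, ∀ m ≥ N, ∀ n ≥ N, vnorm (u m - u n) < ε) →
    ∃ x, ∀ ε > 0, ∃ N, ∀ n ≥ N, vnorm (u n - x) < ε

section ofRuan

variable {V : Type*} [AddCommGroup V] [Module ℂ V]

theorem ruan_add_le (N : ∀ n : ℕ, Matrix (Fin n) (Fin n) V → ℝ) (h0 : ∀ n x, 0 ≤ N n x)
    (hs : ∀ {m n : ℕ} (x : Matrix (Fin m) (Fin m) V) (y : Matrix (Fin n) (Fin n) V),
      N (m + n) (dsum x y) ≤ max (N m x) (N n y))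
    (hb : ∀ {m n : ℕ} (α : Matrix (Fin n) (Fin m) ℂ) (x : Matrix (Fin m) (Fin m) V)
      (β : Matrix (Fin m) (Fin n) ℂ), N n (bimod α x β) ≤ opNorm α * N m x * opNorm β)
    (hc : ∀ {n : ℕ} (c : ℂ) (x : Matrix (Fin n) (Fin n) V), N n (c • x) ≤ ‖c‖ * N n x)
    {n : ℕ} (x y : Matrix (Fin n) (Fin n) V) : N n (x + y) ≤ N n x + N n y := by
  have key : ∀ a b : ℝ, N n x < a → N n y < b → N n (x + y) ≤ a + b := by
    intro a b ha hb'
    have ha0 := (h0 n x).trans_lt ha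
    have hb0 := (h0 n y).trans_lt hb'
    set s : ℂ := (Real.sqrt a : ℂ)
    set t : ℂ := (Real.sqrt b : ℂ)
    have hs2 : s * s = a := by rw [← Complex.ofReal_mul, Real.mul_self_sqrt ha0.le]
    have ht2 : t * t = b := by rw [← Complex.ofReal_mul, Real.mul_self_sqrt hb0.le]
    have hsn : ‖s‖ ^ 2 = a := by
      rw [Complex.norm_real, Real.norm_eq_abs, sq_abs, Real.sq_sqrt ha0.le]
    have htn : ‖t‖ ^ 2 = b := by
      rw [Complex.norm_real, Real.norm_eq_abs, sq_abs, Real.sq_sqrt hb0.le]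
    let R : Matrix (Fin n) (Fin (n + n)) ℂ := Matrix.of fun i =>
      Fin.addCases (fun j => if i = j then s else 0) (fun j => if i = j then t else 0)
    let L : Matrix (Fin (n + n)) (Fin n) ℂ := Matrix.of fun k i =>
      Fin.addCases (fun j => if i = j then s else 0) (fun j => if i = j then t else 0) k
    have e : x + y = bimod R (dsum ((a : ℂ)⁻¹ • x) ((b : ℂ)⁻¹ • y)) L := by
      ext i j
      have ha1 : (a : ℂ) ≠ 0 := by exact_mod_cast ha0.ne'
      have hb1 : (b : ℂ) ≠ 0 := by exact_mod_cast hb0.ne'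
      simp [-Fin.natAdd_eq_addNat, bimod, R, L, Fin.sum_univ_add, smul_smul, hs2, ht2, ha1, hb1]
    have hR : opNorm R ≤ Real.sqrt (a + b) := by
      refine opNorm_le (Real.sqrt_nonneg _) fun z => ?_
      rw [Real.sq_sqrt (by positivity), Fin.sum_univ_add, ← Finset.sum_add_distrib,
        Finset.mul_sum]
      refine Finset.sum_le_sum fun i _ => ?_
      simp only [R, Fin.sum_univ_add, Matrix.of_apply, Fin.addCases_left, Fin.addCases_right,
        ite_mul, zero_mul, Finset.sum_ite_eq, Finset.mem_univ, if_true]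
      have h1 := norm_add_le (s * z (Fin.castAdd n i)) (t * z (Fin.natAdd n i))
      rw [norm_mul, norm_mul] at h1
      have h2 := pow_le_pow_left₀ (norm_nonneg _) h1 2
      refine h2.trans ?_
      rw [← hsn, ← htn]
      nlinarith [sq_nonneg (‖s‖ * ‖z (Fin.natAdd n i)‖ - ‖t‖ * ‖z (Fin.castAdd n i)‖)]
    have hL : opNorm L ≤ Real.sqrt (a + b) := by
      refine opNorm_le (Real.sqrt_nonneg _) fun z => ?_
      rw [Real.sq_sqrt (by positivity), Fin.sum_univ_add, ← Finset.sum_add_distrib,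
        Finset.mul_sum]
      refine Finset.sum_le_sum fun i _ => ?_
      simp only [L, Matrix.of_apply, Fin.addCases_left, Fin.addCases_right,
        ite_mul, zero_mul, Finset.sum_ite_eq', Finset.mem_univ, if_true, norm_mul, mul_pow,
        hsn, htn]
      linarith
    have hx : N n ((a : ℂ)⁻¹ • x) ≤ 1 := by
      refine (hc _ _).trans ?_
      rw [norm_inv, Complex.norm_real, Real.norm_of_nonneg ha0.le, inv_mul_le_iff₀ ha0]
      linarith
    have hy : N n ((b : ℂ)⁻¹ • y) ≤ 1 := by
      refine (hc _ _).trans ?_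
      rw [norm_inv, Complex.norm_real, Real.norm_of_nonneg hb0.le, inv_mul_le_iff₀ hb0]
      linarith
    have hxy := (hs ((a : ℂ)⁻¹ • x) ((b : ℂ)⁻¹ • y)).trans (max_le hx hy)
    rw [e]
    refine (hb _ _ _).trans ?_
    calc opNorm R * N (n + n) _ * opNorm L
        ≤ Real.sqrt (a + b) * 1 * Real.sqrt (a + b) := by
          gcongr
          · exact opNorm_nonneg _
          · exact h0 _ _
      _ = a + b := by rw [mul_one, Real.mul_self_sqrt (by positivity)]
  refine le_of_forall_pos_le_add fun ε hε => ?_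
  have := key (N n x + ε / 2) (N n y + ε / 2) (by linarith) (by linarith)
  linarith

/-- Nonnegative functions satisfying Ruan's conditions are seminorms. -/
@[reducible] noncomputable def PreOperatorSpace.ofRuan (N : ∀ n : ℕ, Matrix (Fin n) (Fin n) V → ℝ)
    (h0 : ∀ n x, 0 ≤ N n x)
    (hs : ∀ {m n : ℕ} (x : Matrix (Fin m) (Fin m) V) (y : Matrix (Fin n) (Fin n) V),
      N (m + n) (dsum x y) ≤ max (N m x) (N n y))
    (hb : ∀ {m n : ℕ} (α : Matrix (Fin n) (Fin m) ℂ) (x : Matrix (Fin m) (Fin m) V)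
      (β : Matrix (Fin m) (Fin n) ℂ), N n (bimod α x β) ≤ opNorm α * N m x * opNorm β) :
    PreOperatorSpace V :=
  have hc : ∀ {n : ℕ} (c : ℂ) (x : Matrix (Fin n) (Fin n) V), N n (c • x) ≤ ‖c‖ * N n x := by
    intro n c x
    rw [← bimod_smul_one]
    refine (hb _ _ _).trans ?_
    rw [opNorm_smul]
    have h1 : opNorm (1 : Matrix (Fin n) (Fin n) ℂ) ≤ 1 := opNorm_one_le
    have h2 := opNorm_nonneg (1 : Matrix (Fin n) (Fin n) ℂ)
    calc ‖c‖ * opNorm (1 : Matrix (Fin n) (Fin n) ℂ) * N n x * opNorm 1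
        ≤ ‖c‖ * 1 * N n x * 1 := by
          have := h0 n x
          gcongr
      _ = _ := by ring
  { mnorm := fun n => Seminorm.ofSMulLE (N n)
      (le_antisymm (by simpa using hc (0 : ℂ) (0 : Matrix (Fin n) (Fin n) V)) (h0 _ _))
      (ruan_add_le N h0 hs hb hc) hc
    mnorm_dsum_le := hs
    mnorm_bimod_le := hb }

end ofRuan

/-- The matrix `(φ (x i j))` of an `n × n` matrix `x`, as an element of `M_n(M_m)`. -/
def amp {V : Type*} [AddCommGroup V] [Module ℂ V] {m n : ℕ}
    (φ : V →ₗ[ℂ] Matrix (Fin m) (Fin m) ℂ) (x : Matrix (Fin n) (Fin n) V) :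
    Matrix (Fin n × Fin m) (Fin n × Fin m) ℂ :=
  Matrix.of fun p q => φ (x p.1 q.1) p.2 q.2

section amp

variable {V : Type*} [AddCommGroup V] [Module ℂ V] {m : ℕ}
    (φ : V →ₗ[ℂ] Matrix (Fin m) (Fin m) ℂ)

theorem opNorm_amp_dsum_le {n n' : ℕ} (x : Matrix (Fin n) (Fin n) V)
    (y : Matrix (Fin n') (Fin n') V) :
    opNorm (amp φ (dsum x y)) ≤ max (opNorm (amp φ x)) (opNorm (amp φ y)) := by
  let f : (Fin n × Fin m) ⊕ (Fin n' × Fin m) → Fin (n + n') × Fin m :=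
    Sum.elim (fun p => (Fin.castAdd n' p.1, p.2)) (fun p => (Fin.natAdd n p.1, p.2))
  have hf : f.Bijective := by
    have : f = ((Equiv.sumProdDistrib (Fin n) (Fin n') (Fin m)).symm.trans
        (finSumFinEquiv.prodCongr (Equiv.refl _))) := by
      funext p
      rcases p with p | p <;> simp [f]
    rw [this]; exact Equiv.bijective _
  refine le_trans (opNorm_pad_le (Matrix.fromBlocks (amp φ x) 0 0 (amp φ y)) _
    hf.injective hf.injective ?_ ?_ ?_) (opNorm_fromBlocks_le _ _)
  · rintro (i | i) (j | j) <;> simp [f, amp, -Fin.natAdd_eq_addNat]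
  · intro i hi; exact absurd (hf.surjective i) hi
  · intro i hi; exact absurd (hf.surjective i) hi

theorem opNorm_amp_bimod_le {n k : ℕ} (α : Matrix (Fin n) (Fin k) ℂ)
    (x : Matrix (Fin k) (Fin k) V) (β : Matrix (Fin k) (Fin n) ℂ) :
    opNorm (amp φ (bimod α x β)) ≤ opNorm α * opNorm (amp φ x) * opNorm β := by
  have e : amp φ (bimod α x β) =
      (Matrix.of fun (i : Fin n × Fin m) (j : Fin k × Fin m) =>
        if i.2 = j.2 then α i.1 j.1 else 0) * amp φ x *
      (Matrix.of fun (i : Fin k × Fin m) (j : Fin n × Fin m) =>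
        if i.2 = j.2 then β i.1 j.1 else 0) := by
    ext p q
    rw [Matrix.mul_assoc]
    simp [amp, bimod, Matrix.mul_apply, Fintype.sum_prod_type, Matrix.sum_apply,
      Finset.mul_sum]
    exact Finset.sum_congr rfl fun _ _ => Finset.sum_congr rfl fun _ _ => by ring
  rw [e]
  refine (opNorm_mul _ _).trans ?_
  refine mul_le_mul ((opNorm_mul _ _).trans (mul_le_mul_of_nonneg_right
    (opNorm_kron_one_le α) (opNorm_nonneg _))) (opNorm_kron_one_le β) (opNorm_nonneg _)
    (mul_nonneg (opNorm_nonneg _) (opNorm_nonneg _))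

theorem opNorm_amp_le {n : ℕ} (x : Matrix (Fin n) (Fin n) V) :
    opNorm (amp φ x) ≤ ∑ i, ∑ j, opNorm (φ (x i j)) := by
  have e : amp φ x = ∑ i, ∑ j, Matrix.of fun p q : Fin n × Fin m =>
      if p.1 = i ∧ q.1 = j then φ (x i j) p.2 q.2 else 0 := by
    ext p q
    simp [amp, Matrix.sum_apply, ite_and]
  rw [e]
  refine (opNorm_sum_le _ _).trans (Finset.sum_le_sum fun i _ =>
    (opNorm_sum_le _ _).trans (Finset.sum_le_sum fun j _ => ?_))
  refine opNorm_pad_le (φ (x i j)) _ (f := fun a => (i, a)) (g := fun a => (j, a))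
    (fun _ _ h => (Prod.mk.inj h).2) (fun _ _ h => (Prod.mk.inj h).2) ?_ ?_ ?_
  · intro a b; simp
  · rintro ⟨p, a⟩ hp q
    have : p ≠ i := fun h => hp ⟨a, by simp [h]⟩
    simp [this]
  · rintro ⟨p, a⟩ hp q
    have : p ≠ j := fun h => hp ⟨a, by simp [h]⟩
    simp [this]

end amp

section constructions

variable {V W : Type*} [AddCommGroup V] [Module ℂ V] [AddCommGroup W] [Module ℂ W]

/-- The matrix seminorms `‖x‖ = sup_i ‖(φ_i (x k l))‖` defined by a pointwise bounded family of
linear maps `φ_i : V → M_{m i}`. -/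
@[reducible] noncomputable def PreOperatorSpace.ofMaps {ι : Type*} (m : ι → ℕ)
    (φ : ∀ i, V →ₗ[ℂ] Matrix (Fin (m i)) (Fin (m i)) ℂ)
    (hφ : ∀ v, ∃ C : ℝ, ∀ i, opNorm (φ i v) ≤ C) : PreOperatorSpace V :=
  have bdd : ∀ {n : ℕ} (x : Matrix (Fin n) (Fin n) V),
      BddAbove (Set.range fun i => opNorm (amp (φ i) x)) := fun x => by
    choose C hC using hφ
    refine ⟨∑ i, ∑ j, C (x i j), ?_⟩
    rintro _ ⟨i, rfl⟩
    exact (opNorm_amp_le _ _).trans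
      (Finset.sum_le_sum fun _ _ => Finset.sum_le_sum fun _ _ => hC _ _)
  PreOperatorSpace.ofRuan (fun _ x => ⨆ i, opNorm (amp (φ i) x))
    (fun _ _ => Real.iSup_nonneg fun _ => opNorm_nonneg _)
    (fun x y => Real.iSup_le (fun i => (opNorm_amp_dsum_le _ _ _).trans
      (max_le_max (le_ciSup (bdd x) i) (le_ciSup (bdd y) i)))
      (le_max_of_le_left (Real.iSup_nonneg fun _ => opNorm_nonneg _)))
    (fun α x β => Real.iSup_le (fun i => (opNorm_amp_bimod_le _ _ _ _).trans
      (by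
        have := le_ciSup (bdd x) i
        have h1 := opNorm_nonneg α
        have h2 := opNorm_nonneg β
        gcongr))
      (mul_nonneg (mul_nonneg (opNorm_nonneg _) (Real.iSup_nonneg fun _ => opNorm_nonneg _))
        (opNorm_nonneg _)))

/-- The matrix seminorms `‖x‖ = ‖(f (x i j))‖` pulled back along a linear map. -/
@[reducible] noncomputable def PreOperatorSpace.comap [PreOperatorSpace W] (f : V →ₗ[ℂ] W) :
    PreOperatorSpace V :=
  PreOperatorSpace.ofRuan (fun n x => PreOperatorSpace.mnorm n (x.map f))
    (fun _ _ => apply_nonneg _ _)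
    (fun x y => by rw [dsum_map]; exact PreOperatorSpace.mnorm_dsum_le _ _)
    (fun α x β => by rw [bimod_map]; exact PreOperatorSpace.mnorm_bimod_le _ _ _)

end constructions

/-- The complex numbers, with the norm of `M_n = B(ℓ²(n))` on `n × n` matrices. -/
noncomputable instance instPreOperatorSpaceComplex : PreOperatorSpace ℂ :=
  PreOperatorSpace.ofRuan (fun _ x => opNorm x) (fun _ _ => opNorm_nonneg _)
    (fun x y => opNorm_dsum_le x y)
    (fun α x β => by
      rw [bimod_eq_mul]
      exact (opNorm_mul _ _).trans
        (mul_le_mul_of_nonneg_right (opNorm_mul _ _) (opNorm_nonneg _)))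

section projective

open scoped TensorProduct

variable {V W : Type*} [AddCommGroup V] [Module ℂ V] [AddCommGroup W] [Module ℂ W]

/-- The Kronecker product `v ⊗ w ∈ M_{pq}(V ⊗ W)` of `v ∈ M_p(V)` and `w ∈ M_q(W)`. -/
def kron {p q : ℕ} (v : Matrix (Fin p) (Fin p) V) (w : Matrix (Fin q) (Fin q) W) :
    Matrix (Fin p × Fin q) (Fin p × Fin q) (V ⊗[ℂ] W) :=
  fun i j => v i.1 j.1 ⊗ₜ[ℂ] w i.2 j.2

theorem kron_smul {p q : ℕ} (a b : ℂ) (v : Matrix (Fin p) (Fin p) V)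
    (w : Matrix (Fin q) (Fin q) W) : kron (a • v) (b • w) = (a * b) • kron v w := by
  ext i j
  simp only [kron, Matrix.smul_apply, TensorProduct.smul_tmul_smul]

variable [PreOperatorSpace V] [PreOperatorSpace W]

/-- The numbers `‖α‖ ‖v‖ ‖w‖ ‖β‖` for all factorizations `U = α (v ⊗ w) β`. -/
def projSet {n : ℕ} (U : Matrix (Fin n) (Fin n) (V ⊗[ℂ] W)) : Set ℝ :=
  {r | ∃ (p q : ℕ) (v : Matrix (Fin p) (Fin p) V) (w : Matrix (Fin q) (Fin q) W)
    (α : Matrix (Fin n) (Fin p × Fin q) ℂ) (β : Matrix (Fin p × Fin q) (Fin n) ℂ),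
    U = bimod α (kron v w) β ∧
    r = opNorm α * PreOperatorSpace.mnorm p v * PreOperatorSpace.mnorm q w * opNorm β}

/-- The operator space projective tensor norm on `M_n(V ⊗ W)`. -/
noncomputable def projNorm {n : ℕ} (U : Matrix (Fin n) (Fin n) (V ⊗[ℂ] W)) : ℝ :=
  sInf (projSet U)

theorem projSet_nonneg {n : ℕ} {U : Matrix (Fin n) (Fin n) (V ⊗[ℂ] W)} :
    ∀ r ∈ projSet U, 0 ≤ r := by
  rintro r ⟨p, q, v, w, α, β, -, rfl⟩
  have h1 := opNorm_nonneg α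
  have h2 := opNorm_nonneg β
  positivity

theorem projNorm_nonneg {n : ℕ} (U : Matrix (Fin n) (Fin n) (V ⊗[ℂ] W)) : 0 ≤ projNorm U :=
  Real.sInf_nonneg projSet_nonneg

theorem bddBelow_projSet {n : ℕ} (U : Matrix (Fin n) (Fin n) (V ⊗[ℂ] W)) :
    BddBelow (projSet U) := ⟨0, fun _ hr => projSet_nonneg _ hr⟩

/-- A normalized factorization `U = α (v ⊗ w) β`. -/
def HasFact {n : ℕ} (U : Matrix (Fin n) (Fin n) (V ⊗[ℂ] W)) (r : ℝ) : Prop :=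
  ∃ (p q : ℕ) (v : Matrix (Fin p) (Fin p) V) (w : Matrix (Fin q) (Fin q) W)
    (α : Matrix (Fin n) (Fin p × Fin q) ℂ) (β : Matrix (Fin p × Fin q) (Fin n) ℂ),
    U = bimod α (kron v w) β ∧ PreOperatorSpace.mnorm p v ≤ 1 ∧
    PreOperatorSpace.mnorm q w ≤ 1 ∧ opNorm α ≤ 1 ∧ opNorm β ≤ r

theorem exists_mul_lt {a b c d r : ℝ} (h : a * b * c * d < r) :
    ∃ δ > 0, (a + δ) * (b + δ) * (c + δ) * (d + δ) < r := by
  have hc : ContinuousAt (fun δ : ℝ => (a + δ) * (b + δ) * (c + δ) * (d + δ)) 0 := by fun_prop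
  have := hc.eventually_lt (continuousAt_const (y := r)) (by simpa using h)
  obtain ⟨ε, hε, H⟩ := Metric.eventually_nhds_iff.1 this
  refine ⟨ε / 2, by positivity, H ?_⟩
  rw [Real.dist_eq, sub_zero, abs_of_pos (by positivity)]
  linarith

theorem hasFact_of_mem {n : ℕ} {U : Matrix (Fin n) (Fin n) (V ⊗[ℂ] W)} {s r : ℝ}
    (hs : s ∈ projSet U) (hr : s < r) : HasFact U r := by
  obtain ⟨p, q, v, w, α, β, hU, rfl⟩ := hs
  obtain ⟨δ, hδ, H⟩ := exists_mul_lt hr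
  set a := opNorm α + δ with ha
  set x := PreOperatorSpace.mnorm p v + δ with hx
  set y := PreOperatorSpace.mnorm q w + δ with hy
  set b := opNorm β + δ with hb
  have ha0 : 0 < a := add_pos_of_nonneg_of_pos (opNorm_nonneg _) hδ
  have hb0 : 0 < b := add_pos_of_nonneg_of_pos (opNorm_nonneg _) hδ
  have hx0 : 0 < x := add_pos_of_nonneg_of_pos (apply_nonneg _ _) hδ
  have hy0 : 0 < y := add_pos_of_nonneg_of_pos (apply_nonneg _ _) hδ
  have ha1 : (a : ℂ) ≠ 0 := by exact_mod_cast ha0.ne'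
  have hx1 : (x : ℂ) ≠ 0 := by exact_mod_cast hx0.ne'
  have hy1 : (y : ℂ) ≠ 0 := by exact_mod_cast hy0.ne'
  refine ⟨p, q, (x : ℂ)⁻¹ • v, (y : ℂ)⁻¹ • w, (a : ℂ)⁻¹ • α, ((a * x * y : ℝ) : ℂ) • β,
    ?_, ?_, ?_, ?_, ?_⟩
  · rw [kron_smul, hU]
    ext i j
    simp only [bimod, Matrix.smul_apply, smul_smul, smul_eq_mul]
    refine Finset.sum_congr rfl fun _ _ => Finset.sum_congr rfl fun _ _ => ?_
    congr 1
    push_cast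
    field_simp
  · rw [map_smul_eq_mul, norm_inv, Complex.norm_real, Real.norm_of_nonneg hx0.le,
      inv_mul_le_iff₀ hx0]
    linarith
  · rw [map_smul_eq_mul, norm_inv, Complex.norm_real, Real.norm_of_nonneg hy0.le,
      inv_mul_le_iff₀ hy0]
    linarith
  · rw [opNorm_smul, norm_inv, Complex.norm_real, Real.norm_of_nonneg ha0.le,
      inv_mul_le_iff₀ ha0]
    linarith
  · rw [opNorm_smul, Complex.norm_real, Real.norm_of_nonneg (by positivity)]
    have : a * x * y * opNorm β ≤ a * x * y * b := by
      gcongr; linarith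
    linarith

theorem projNorm_le_of_hasFact {n : ℕ} {U : Matrix (Fin n) (Fin n) (V ⊗[ℂ] W)} {r : ℝ}
    (h : HasFact U r) : projNorm U ≤ r := by
  obtain ⟨p, q, v, w, α, β, hU, hv, hw, hα, hβ⟩ := h
  refine (csInf_le (bddBelow_projSet U) ⟨p, q, v, w, α, β, hU, rfl⟩).trans ?_
  have h1 := opNorm_nonneg α
  have h2 := opNorm_nonneg β
  calc _ ≤ 1 * 1 * 1 * opNorm β := by gcongr
    _ ≤ r := by linarith

theorem HasFact.mono {n : ℕ} {U : Matrix (Fin n) (Fin n) (V ⊗[ℂ] W)} {r s : ℝ}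
    (h : HasFact U r) (hrs : r ≤ s) : HasFact U s := by
  obtain ⟨p, q, v, w, α, β, hU, hv, hw, hα, hβ⟩ := h
  exact ⟨p, q, v, w, α, β, hU, hv, hw, hα, hβ.trans hrs⟩

theorem HasFact.dsum {n n' : ℕ} {U : Matrix (Fin n) (Fin n) (V ⊗[ℂ] W)}
    {U' : Matrix (Fin n') (Fin n') (V ⊗[ℂ] W)} {r : ℝ} (h : HasFact U r) (h' : HasFact U' r) :
    HasFact (OpSp.dsum U U') r := by
  obtain ⟨p, q, v, w, α, β, hU, hv, hw, hα, hβ⟩ := h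
  obtain ⟨p', q', v', w', α', β', hU', hv', hw', hα', hβ'⟩ := h'
  let e : (Fin p × Fin q) ⊕ (Fin p' × Fin q') → Fin (p + p') × Fin (q + q') :=
    Sum.elim (fun k => (Fin.castAdd p' k.1, Fin.castAdd q' k.2))
      (fun k => (Fin.natAdd p k.1, Fin.natAdd q k.2))
  have he : e.Injective := by
    rintro (⟨i, i'⟩ | ⟨i, i'⟩) (⟨j, j'⟩ | ⟨j, j'⟩) hij <;>
      simp only [e, Sum.elim_inl, Sum.elim_inr, Prod.mk.injEq, Fin.ext_iff, Fin.val_castAdd,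
        Fin.val_natAdd] at hij
    · simp [Fin.ext_iff, hij.1, hij.2]
    · have := i.2; omega
    · have := j.2; omega
    · have h1 : i = j := Fin.ext (by omega)
      have h2 : i' = j' := Fin.ext (by omega)
      simp [h1, h2]
  let P : Matrix ((Fin p × Fin q) ⊕ (Fin p' × Fin q')) (Fin (p + p') × Fin (q + q')) ℂ :=
    Matrix.of fun s k => if e s = k then 1 else 0
  let Q : Matrix (Fin (p + p') × Fin (q + q')) ((Fin p × Fin q) ⊕ (Fin p' × Fin q')) ℂ :=
    Matrix.of fun k s => if e s = k then 1 else 0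
  have hP : opNorm P ≤ 1 := by
    refine le_trans (opNorm_pad_le (1 : Matrix ((Fin p × Fin q) ⊕ (Fin p' × Fin q')) _ ℂ) P
      (f := id) Function.injective_id he ?_ ?_ ?_) opNorm_one_le
    · intro i j; simp [P, Matrix.one_apply, he.eq_iff]
    · intro i hi; simp at hi
    · intro k hk s
      have : e s ≠ k := fun h => hk ⟨s, h⟩
      simp [P, this]
  have hQ : opNorm Q ≤ 1 := by
    refine le_trans (opNorm_pad_le (1 : Matrix ((Fin p × Fin q) ⊕ (Fin p' × Fin q')) _ ℂ) Q
      (g := id) he Function.injective_id ?_ ?_ ?_) opNorm_one_le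
    · intro i j; simp [Q, Matrix.one_apply, he.eq_iff, eq_comm]
    · intro k hk s
      have : e s ≠ k := fun h => hk ⟨s, h⟩
      simp [Q, this]
    · intro i hi; simp at hi
  let A : Matrix (Fin (n + n')) ((Fin p × Fin q) ⊕ (Fin p' × Fin q')) ℂ :=
    (Matrix.fromBlocks α 0 0 α').submatrix finSumFinEquiv.symm id
  let B : Matrix ((Fin p × Fin q) ⊕ (Fin p' × Fin q')) (Fin (n + n')) ℂ :=
    (Matrix.fromBlocks β 0 0 β').submatrix id finSumFinEquiv.symm
  have hA : opNorm A ≤ 1 := by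
    refine le_trans (opNorm_pad_le (Matrix.fromBlocks α 0 0 α') A
      finSumFinEquiv.injective Function.injective_id ?_ ?_ ?_)
      ((opNorm_fromBlocks_le _ _).trans (max_le hα hα'))
    · intro i j; simp [A]
    · intro i hi; exact absurd (finSumFinEquiv.surjective i) hi
    · intro i hi; simp at hi
  have hB : opNorm B ≤ r := by
    refine le_trans (opNorm_pad_le (Matrix.fromBlocks β 0 0 β') B
      Function.injective_id finSumFinEquiv.injective ?_ ?_ ?_)
      ((opNorm_fromBlocks_le _ _).trans (max_le hβ hβ'))
    · intro i j; simp [B]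
    · intro i hi; simp at hi
    · intro i hi; exact absurd (finSumFinEquiv.surjective i) hi
  refine ⟨p + p', q + q', OpSp.dsum v v', OpSp.dsum w w', A * P, Q * B, ?_, ?_, ?_, ?_, ?_⟩
  · rw [← bimod_bimod]
    have e1 : bimod P (kron (OpSp.dsum v v') (OpSp.dsum w w')) Q =
        Matrix.fromBlocks (kron v w) 0 0 (kron v' w') := by
      ext i j
      simp only [bimod, P, Q, Matrix.of_apply, mul_ite, mul_one, mul_zero, ite_smul,
        one_smul, zero_smul, Finset.sum_ite_eq, Finset.mem_univ, if_true]
      rcases i with i | i <;> rcases j with j | j <;>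
        simp [e, kron, -Fin.natAdd_eq_addNat]
    rw [e1, hU, hU']
    ext i j
    refine Fin.addCases (fun i => ?_) (fun i => ?_) i <;>
    refine Fin.addCases (fun j => ?_) (fun j => ?_) j <;>
    simp [bimod, A, B, -Fin.natAdd_eq_addNat]
  · exact (PreOperatorSpace.mnorm_dsum_le _ _).trans (max_le hv hv')
  · exact (PreOperatorSpace.mnorm_dsum_le _ _).trans (max_le hw hw')
  · refine (opNorm_mul _ _).trans ?_
    have := opNorm_nonneg P
    nlinarith
  · refine (opNorm_mul _ _).trans ?_
    have := opNorm_nonneg B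
    nlinarith

theorem HasFact.bimod {m n : ℕ} {U : Matrix (Fin m) (Fin m) (V ⊗[ℂ] W)} {r : ℝ}
    (h : HasFact U r) (γ : Matrix (Fin n) (Fin m) ℂ) (δ : Matrix (Fin m) (Fin n) ℂ) :
    ∃ s ∈ projSet (OpSp.bimod γ U δ), s ≤ opNorm γ * r * opNorm δ := by
  obtain ⟨p, q, v, w, α, β, hU, hv, hw, hα, hβ⟩ := h
  refine ⟨_, ⟨p, q, v, w, γ * α, β * δ, by rw [← bimod_bimod, hU], rfl⟩, ?_⟩
  have h1 := opNorm_mul γ α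
  have h2 := opNorm_mul β δ
  have g1 := opNorm_nonneg γ
  have g2 := opNorm_nonneg δ
  have g3 := opNorm_nonneg α
  have g4 := opNorm_nonneg β
  have g5 := opNorm_nonneg (γ * α)
  have g6 := opNorm_nonneg (β * δ)
  calc _ ≤ (opNorm γ * 1) * 1 * 1 * (r * opNorm δ) := by
        gcongr
        · exact h1.trans (by gcongr)
        · exact h2.trans (by gcongr)
    _ = _ := by ring

/-- Matrices over `V ⊗ W` have factorizations `α (v ⊗ w) β`. -/
theorem projSet_nonempty {n : ℕ} (U : Matrix (Fin n) (Fin n) (V ⊗[ℂ] W)) :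
    (projSet U).Nonempty := by
  have add : ∀ U U' : Matrix (Fin n) (Fin n) (V ⊗[ℂ] W), (projSet U).Nonempty →
      (projSet U').Nonempty → (projSet (U + U')).Nonempty := by
    rintro U U' ⟨s, hs⟩ ⟨s', hs'⟩
    have h := hasFact_of_mem hs (r := max s s' + 1) (by linarith [le_max_left s s'])
    have h' := hasFact_of_mem hs' (r := max s s' + 1) (by linarith [le_max_right s s'])
    obtain ⟨t, ht, -⟩ := (h.dsum h').bimod
      (Matrix.of fun i => Fin.addCases (fun j => if i = j then 1 else 0)
        (fun j => if i = j then 1 else 0))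
      (Matrix.of fun k i => Fin.addCases (fun j => if i = j then 1 else 0)
        (fun j => if i = j then 1 else 0) k)
    refine ⟨t, ?_⟩
    convert ht
    ext i j
    simp [-Fin.natAdd_eq_addNat, OpSp.bimod, Fin.sum_univ_add]
  have zero : (projSet (0 : Matrix (Fin n) (Fin n) (V ⊗[ℂ] W))).Nonempty :=
    ⟨_, 0, 0, 0, 0, 0, 0, by ext i j; simp [OpSp.bimod], rfl⟩
  have sum : ∀ {ι : Type} (s : Finset ι) (F : ι → Matrix (Fin n) (Fin n) (V ⊗[ℂ] W)),
      (∀ i, (projSet (F i)).Nonempty) → (projSet (∑ i ∈ s, F i)).Nonempty := by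
    intro ι s F hF
    classical
    induction s using Finset.induction_on with
    | empty => simpa using zero
    | insert a s ha ih => rw [Finset.sum_insert ha]; exact add _ _ (hF a) ih
  rw [Matrix.matrix_eq_sum_single U]
  refine sum _ _ fun i => sum _ _ fun j => ?_
  induction U i j using TensorProduct.induction_on with
  | zero => simpa using zero
  | tmul v w =>
    refine ⟨_, 1, 1, fun _ _ => v, fun _ _ => w, fun k _ => if k = i then 1 else 0,
      fun _ k => if k = j then 1 else 0, ?_, rfl⟩
    ext k l
    simp only [OpSp.bimod, kron, Matrix.single, Matrix.of_apply, ite_and, Finset.sum_const,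
      Finset.card_univ, Fintype.card_prod, Fintype.card_fin, mul_one, one_smul, ite_mul, one_mul,
      zero_mul, ite_smul, zero_smul]
    split_ifs <;> simp_all
  | add x y hx hy => rw [Matrix.single_add]; exact add _ _ hx hy

theorem hasFact_of_lt {n : ℕ} {U : Matrix (Fin n) (Fin n) (V ⊗[ℂ] W)} {r : ℝ}
    (h : projNorm U < r) : HasFact U r := by
  obtain ⟨s, hs, hsr⟩ := exists_lt_of_csInf_lt (projSet_nonempty U) h
  exact hasFact_of_mem hs hsr

/-- The algebraic tensor product with the operator space projective tensor norms. -/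
noncomputable instance instPreOperatorSpaceTensor : PreOperatorSpace (V ⊗[ℂ] W) :=
  PreOperatorSpace.ofRuan (fun _ U => projNorm U) (fun _ U => projNorm_nonneg U)
    (fun x y => le_of_forall_gt_imp_ge_of_dense fun r hr =>
      projNorm_le_of_hasFact ((hasFact_of_lt ((le_max_left _ _).trans_lt hr)).dsum
        (hasFact_of_lt ((le_max_right _ _).trans_lt hr))))
    (fun α x β => by
      have h1 := opNorm_nonneg α
      have h2 := opNorm_nonneg β
      have key : ∀ r > projNorm x, projNorm (bimod α x β) ≤ opNorm α * r * opNorm β := by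
        intro r hr
        obtain ⟨s, hs, hsr⟩ := (hasFact_of_lt hr).bimod α β
        exact (csInf_le (bddBelow_projSet _) hs).trans hsr
      refine ge_of_tendsto (x := nhdsWithin (projNorm x) (Set.Ioi (projNorm x)))
        (f := fun r => opNorm α * r * opNorm β) ?_
        (eventually_nhdsWithin_of_forall fun r hr => key r hr)
      refine Filter.Tendsto.mono_left ?_ nhdsWithin_le_nhds
      exact (Continuous.tendsto (by fun_prop) _))

end projective

section completion

open UniformSpace

variable (V : Type*) [AddCommGroup V] [Module ℂ V] [PreOperatorSpace V]

/-- A pre-operator space, regarded as a seminormed space. -/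
def AsSeminormed : Type _ := V

variable {V}

theorem mnorm_le_sum {n : ℕ} (x : Matrix (Fin n) (Fin n) V) :
    PreOperatorSpace.mnorm n x ≤ ∑ i, ∑ j, vnorm (x i j) := by
  have e : x = ∑ i, ∑ j, bimod (Matrix.of fun (k : Fin n) (_ : Fin 1) => if k = i then (1 : ℂ) else 0)
      (Matrix.of fun _ _ => x i j) (Matrix.of fun (_ : Fin 1) k => if k = j then (1 : ℂ) else 0) := by
    ext k l
    simp [Matrix.sum_apply, bimod]
  have key : ∀ i j, PreOperatorSpace.mnorm n (bimod
      (Matrix.of fun (k : Fin n) (_ : Fin 1) => if k = i then (1 : ℂ) else 0)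
      (Matrix.of fun _ _ => x i j)
      (Matrix.of fun (_ : Fin 1) k => if k = j then (1 : ℂ) else 0)) ≤ vnorm (x i j) := by
    intro i j
    refine (PreOperatorSpace.mnorm_bimod_le _ _ _).trans ?_
    have h1 : opNorm (Matrix.of fun (k : Fin n) (_ : Fin 1) => if k = i then (1 : ℂ) else 0)
        ≤ 1 := opNorm_le zero_le_one fun z => by
      simp only [Matrix.of_apply, Fin.sum_univ_one]
      rw [Finset.sum_eq_single i] <;> simp +contextual
    have h2 : opNorm (Matrix.of fun (_ : Fin 1) (k : Fin n) => if k = j then (1 : ℂ) else 0)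
        ≤ 1 := opNorm_le zero_le_one fun z => by
      simp only [Matrix.of_apply, Fin.sum_univ_one, ite_mul, one_mul, zero_mul,
        Finset.sum_ite_eq', Finset.mem_univ, if_true, one_pow]
      exact Finset.single_le_sum (f := fun k => ‖z k‖ ^ 2) (fun _ _ => sq_nonneg _)
        (Finset.mem_univ j)
    have h3 := opNorm_nonneg (Matrix.of fun (_ : Fin 1) (k : Fin n) => if k = j then (1 : ℂ) else 0)
    have h4 : 0 ≤ vnorm (x i j) := apply_nonneg _ _
    calc _ ≤ 1 * vnorm (x i j) * 1 := by
          unfold vnorm at h4 ⊢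
          gcongr
      _ = _ := by ring
  conv_lhs => rw [e]
  have sub : ∀ (F : Fin n → Matrix (Fin n) (Fin n) V),
      PreOperatorSpace.mnorm n (∑ i, F i) ≤ ∑ i, PreOperatorSpace.mnorm n (F i) := fun F =>
    Finset.le_sum_of_subadditive _ (map_zero _).le (map_add_le_add _) _ _
  exact (sub _).trans (Finset.sum_le_sum fun i _ => (sub _).trans
    (Finset.sum_le_sum fun j _ => key i j))

theorem vnorm_zero : vnorm (0 : V) = 0 := map_zero (PreOperatorSpace.mnorm (V := V) 1)
theorem vnorm_add_le (x y : V) : vnorm (x + y) ≤ vnorm x + vnorm y :=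
  map_add_le_add (PreOperatorSpace.mnorm (V := V) 1) _ _
theorem vnorm_smul (c : ℂ) (x : V) : vnorm (c • x) = ‖c‖ * vnorm x :=
  map_smul_eq_mul (PreOperatorSpace.mnorm (V := V) 1) _ _

noncomputable instance : SeminormedAddCommGroup (AsSeminormed V) :=
  AddGroupSeminorm.toSeminormedAddCommGroup (E := V)
    { toFun := vnorm
      map_zero' := vnorm_zero
      add_le' := vnorm_add_le
      neg' := fun x => by
        rw [← neg_one_smul ℂ x, vnorm_smul]; simp }

noncomputable instance : NormedSpace ℂ (AsSeminormed V) where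
  toModule := inferInstanceAs (Module ℂ V)
  norm_smul_le c x := (vnorm_smul (V := V) c x).le

variable (V) in
/-- The completion of a pre-operator space with respect to `vnorm`. -/
abbrev OSCompletion : Type _ := Completion (AsSeminormed V)

variable (V) in
/-- The canonical map of a pre-operator space to its completion. -/
noncomputable def OSCompletion.of : V →ₗ[ℂ] OSCompletion V where
  toFun v := @Completion.coe' (AsSeminormed V) _ v
  map_add' x y := Completion.coe_add (α := AsSeminormed V) x y
  map_smul' c x := Completion.coe_smul (X := AsSeminormed V) c x

theorem norm_of (v : V) : ‖OSCompletion.of V v‖ = vnorm v :=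
  Completion.norm_coe (E := AsSeminormed V) v

/-- The canonical map from matrices over `V` to matrices over its completion. -/
noncomputable def toCompletion (n : ℕ) (x : Matrix (Fin n) (Fin n) (AsSeminormed V)) :
    Matrix (Fin n) (Fin n) (OSCompletion V) :=
  Matrix.of fun i j => OSCompletion.of V (x i j)

theorem isUniformInducing_toCompletion (n : ℕ) :
    IsUniformInducing (toCompletion (V := V) n) := by
  constructor
  rw [Matrix.uniformity, Matrix.uniformity]
  simp only [Filter.comap_iInf, Filter.comap_comap]
  refine iInf_congr fun i => iInf_congr fun j => ?_
  rw [← (Completion.isUniformInducing_coe (AsSeminormed V)).comap_uniformity,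
    Filter.comap_comap]
  rfl

theorem denseRange_toCompletion (n : ℕ) : DenseRange (toCompletion (V := V) n) :=
  DenseRange.piMap (f := fun (_ : Fin n) (x : Fin n → AsSeminormed V) (j : Fin n) =>
      (x j : Completion (AsSeminormed V))) fun _ =>
    DenseRange.piMap (f := fun (_ : Fin n) (x : AsSeminormed V) =>
      (x : Completion (AsSeminormed V))) fun _ => Completion.denseRange_coe

/-- The matrix seminorm as a function on matrices over the seminormed space. -/
noncomputable def mnormFun (n : ℕ) (x : Matrix (Fin n) (Fin n) (AsSeminormed V)) : ℝ :=
  PreOperatorSpace.mnorm (V := V) n x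

theorem uniformContinuous_mnormFun (n : ℕ) : UniformContinuous (mnormFun (V := V) n) := by
  rw [UniformContinuous, tendsto_uniformity_iff_dist_tendsto_zero]
  have h : ∀ p : Matrix (Fin n) (Fin n) (AsSeminormed V) × Matrix (Fin n) (Fin n) (AsSeminormed V),
      dist (mnormFun n p.1) (mnormFun n p.2) ≤ ∑ i, ∑ j, dist (p.1 i j) (p.2 i j) := by
    intro p
    have h1 : dist (mnormFun n p.1) (mnormFun n p.2) ≤
        PreOperatorSpace.mnorm (V := V) n (p.1 - p.2) := by
      rw [Real.dist_eq]
      exact abs_sub_map_le_sub (PreOperatorSpace.mnorm (V := V) n) p.1 p.2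
    refine h1.trans ((mnorm_le_sum (V := V) _).trans (le_of_eq ?_))
    refine Finset.sum_congr rfl fun i _ => Finset.sum_congr rfl fun j _ => ?_
    rw [dist_eq_norm]
    rfl
  refine squeeze_zero (fun _ => dist_nonneg) h ?_
  have : (0 : ℝ) = ∑ i : Fin n, ∑ j : Fin n, (0 : ℝ) := by simp
  rw [this]
  refine tendsto_finsetSum _ fun i _ => tendsto_finsetSum _ fun j _ => ?_
  have hu : UniformContinuous fun x : Matrix (Fin n) (Fin n) (AsSeminormed V) => x i j :=
    (Matrix.uniformContinuous _ _ _).1 uniformContinuous_id i j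
  exact tendsto_uniformity_iff_dist_tendsto_zero.1 hu

/-- The extension by continuity of the matrix seminorms to the completion. -/
noncomputable def completionNorm (n : ℕ) (U : Matrix (Fin n) (Fin n) (OSCompletion V)) : ℝ :=
  ((isUniformInducing_toCompletion n).isDenseInducing (denseRange_toCompletion n)).extend
    (mnormFun n) U

theorem completionNorm_toCompletion (n : ℕ) (x : Matrix (Fin n) (Fin n) (AsSeminormed V)) :
    completionNorm n (toCompletion n x) = mnormFun n x :=
  uniformly_extend_of_ind (isUniformInducing_toCompletion n) (denseRange_toCompletion n) (uniformContinuous_mnormFun n) x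

theorem continuous_completionNorm (n : ℕ) : Continuous (completionNorm (V := V) n) :=
  (uniformContinuous_uniformly_extend (isUniformInducing_toCompletion n)
    (denseRange_toCompletion n) (uniformContinuous_mnormFun n)).continuous

theorem toCompletion_dsum {m n : ℕ} (x : Matrix (Fin m) (Fin m) (AsSeminormed V))
    (y : Matrix (Fin n) (Fin n) (AsSeminormed V)) :
    dsum (toCompletion m x) (toCompletion n y) = toCompletion (m + n) (dsum x y) :=
  (dsum_map (OSCompletion.of V) x y).symm

theorem toCompletion_bimod {m n : ℕ} (α : Matrix (Fin n) (Fin m) ℂ)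
    (x : Matrix (Fin m) (Fin m) (AsSeminormed V)) (β : Matrix (Fin m) (Fin n) ℂ) :
    bimod α (toCompletion m x) β = toCompletion n (bimod α x β) :=
  (bimod_map (OSCompletion.of V) α x β).symm

theorem completionNorm_dsum_le {m n : ℕ} (x : Matrix (Fin m) (Fin m) (OSCompletion V))
    (y : Matrix (Fin n) (Fin n) (OSCompletion V)) :
    completionNorm (m + n) (dsum x y) ≤ max (completionNorm m x) (completionNorm n y) := by
  have hc : Continuous fun p : Matrix (Fin m) (Fin m) (OSCompletion V) ×
      Matrix (Fin n) (Fin n) (OSCompletion V) => dsum p.1 p.2 := by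
    refine continuous_matrix fun i j => ?_
    refine Fin.addCases (fun i => ?_) (fun i => ?_) i <;>
    refine Fin.addCases (fun j => ?_) (fun j => ?_) j <;>
    simp only [dsum_ll, dsum_lr, dsum_rl, dsum_rr]
    · exact continuous_fst.matrix_elem i j
    · exact continuous_const
    · exact continuous_const
    · exact continuous_snd.matrix_elem i j
  have hcl : IsClosed {p : Matrix (Fin m) (Fin m) (OSCompletion V) ×
      Matrix (Fin n) (Fin n) (OSCompletion V) | completionNorm (m + n) (dsum p.1 p.2) ≤
        max (completionNorm m p.1) (completionNorm n p.2)} :=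
    isClosed_le ((continuous_completionNorm _).comp hc)
      (((continuous_completionNorm _).comp continuous_fst).max
        ((continuous_completionNorm _).comp continuous_snd))
  have h : ∀ (x : Matrix (Fin m) (Fin m) (AsSeminormed V))
      (y : Matrix (Fin n) (Fin n) (AsSeminormed V)),
      completionNorm (m + n) (dsum (toCompletion m x) (toCompletion n y)) ≤
        max (completionNorm m (toCompletion m x)) (completionNorm n (toCompletion n y)) := by
    intro x y
    rw [toCompletion_dsum, completionNorm_toCompletion, completionNorm_toCompletion,
      completionNorm_toCompletion]
    exact PreOperatorSpace.mnorm_dsum_le (V := V) x y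
  exact isClosed_property ((denseRange_toCompletion m).prodMap (denseRange_toCompletion n))
    hcl (fun p => h p.1 p.2) (x, y)

theorem completionNorm_bimod_le {m n : ℕ} (α : Matrix (Fin n) (Fin m) ℂ)
    (x : Matrix (Fin m) (Fin m) (OSCompletion V)) (β : Matrix (Fin m) (Fin n) ℂ) :
    completionNorm n (bimod α x β) ≤ opNorm α * completionNorm m x * opNorm β := by
    have hc : Continuous fun p : Matrix (Fin m) (Fin m) (OSCompletion V) => bimod α p β := by
      refine continuous_matrix fun i j => ?_
      unfold bimod
      exact continuous_finsetSum _ fun a _ => continuous_finsetSum _ fun b _ =>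
        (continuous_const_smul (α i a * β b j)).comp (continuous_id.matrix_elem a b)
    refine (denseRange_toCompletion m).induction_on x
      (isClosed_le ((continuous_completionNorm _).comp hc)
        ((continuous_const.mul (continuous_completionNorm _)).mul continuous_const)) ?_
    intro x
    rw [toCompletion_bimod, completionNorm_toCompletion, completionNorm_toCompletion]
    exact PreOperatorSpace.mnorm_bimod_le (V := V) α x β

/-- The completion of a pre-operator space, with the matrix norms extended by continuity. -/
@[reducible] noncomputable def completionPreOperatorSpace : PreOperatorSpace (OSCompletion V) :=
  PreOperatorSpace.ofRuan completionNorm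
    (fun n U => (denseRange_toCompletion n).induction_on U
      (isClosed_le continuous_const (continuous_completionNorm n))
      fun x => by rw [completionNorm_toCompletion]; exact apply_nonneg _ _)
    completionNorm_dsum_le completionNorm_bimod_le

theorem completionNorm_one (x : OSCompletion V) :
    completionNorm 1 (Matrix.of fun _ _ => x) = ‖x‖ := by
  induction x using Completion.induction_on with
  | hp =>
    exact isClosed_eq ((continuous_completionNorm 1).comp
      (continuous_matrix fun _ _ => continuous_id)) continuous_norm
  | ih x =>
    rw [Completion.norm_coe]
    exact completionNorm_toCompletion 1 (Matrix.of fun _ _ => x)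

noncomputable instance instOperatorSpaceCompletion : OperatorSpace (OSCompletion V) where
  toPreOperatorSpace := completionPreOperatorSpace
  eq_zero_of_vnorm x hx := norm_eq_zero.1 ((completionNorm_one x).symm.trans hx)
  complete u hu := by
    have e : ∀ x : OSCompletion V, @vnorm _ _ _ completionPreOperatorSpace x = ‖x‖ :=
      completionNorm_one
    simp only [e, ← dist_eq_norm] at hu ⊢
    obtain ⟨x, hx⟩ := cauchySeq_tendsto_of_complete (Metric.cauchySeq_iff.2 hu)
    exact ⟨x, Metric.tendsto_atTop.1 hx⟩

end completion

section maps

variable {V W : Type*} [AddCommGroup V] [Module ℂ V] [PreOperatorSpace V]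
  [AddCommGroup W] [Module ℂ W] [PreOperatorSpace W]

/-- A linear map `u` such that all the maps `(x i j) ↦ (u (x i j))` are isometric. -/
def IsCompleteIsometry (u : V →ₗ[ℂ] W) : Prop :=
  ∀ (n : ℕ) (x : Matrix (Fin n) (Fin n) V),
    PreOperatorSpace.mnorm n (x.map u) = PreOperatorSpace.mnorm n x

/-- A complete contraction with values in `M_m`. -/
def IsCompleteContraction {m : ℕ} (φ : V →ₗ[ℂ] Matrix (Fin m) (Fin m) ℂ) : Prop :=
  ∀ (n : ℕ) (x : Matrix (Fin n) (Fin n) V), opNorm (amp φ x) ≤ PreOperatorSpace.mnorm n x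

theorem IsCompleteContraction.opNorm_le {m : ℕ} {φ : V →ₗ[ℂ] Matrix (Fin m) (Fin m) ℂ}
    (h : IsCompleteContraction φ) (x : V) : opNorm (φ x) ≤ vnorm x := by
  refine le_trans ?_ (h 1 (Matrix.of fun _ _ => x))
  have hs : ∀ k : Fin m, k ∈ Set.range (Prod.snd : Fin 1 × Fin m → Fin m) :=
    fun k => ⟨(0, k), rfl⟩
  have hi : (Prod.snd : Fin 1 × Fin m → Fin m).Injective := fun a b hab =>
    Prod.ext (Subsingleton.elim _ _) hab
  exact opNorm_pad_le _ _ hi hi (fun i j => rfl) (fun k hk => absurd (hs k) hk)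
    (fun k hk => absurd (hs k) hk)

end maps

/-- The completed operator space projective tensor product. -/
abbrev ProjTensor (V W : Type*) [AddCommGroup V] [Module ℂ V] [PreOperatorSpace V]
    [AddCommGroup W] [Module ℂ W] [PreOperatorSpace W] : Type _ :=
  OSCompletion (TensorProduct ℂ V W)

theorem opNorm_submatrix_le {l m n o : Type*} [Fintype l] [Fintype m] [Fintype n] [Fintype o]
    [DecidableEq n] [DecidableEq o] (A : Matrix l o ℂ) {f : m → l} {g : n → o}
    (hf : f.Injective) (hg : g.Injective) : opNorm (A.submatrix f g) ≤ opNorm A := by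
  classical
  refine opNorm_le (opNorm_nonneg _) fun x => ?_
  have h := sum_mulVec_le A (Function.extend g x 0)
  have e1 : ∀ i, ∑ j, A i (g j) * x j = ∑ j, A i j * Function.extend g x 0 j := fun i =>
    Fintype.sum_of_injective g hg _ _
      (fun j hj => by rw [Function.extend_apply' _ _ _ hj, Pi.zero_apply, mul_zero])
      (fun j => by rw [hg.extend_apply])
  have e2 : ∑ j, ‖x j‖ ^ 2 = ∑ j, ‖Function.extend g x 0 j‖ ^ 2 :=
    Fintype.sum_of_injective g hg _ _
      (fun j hj => by rw [Function.extend_apply' _ _ _ hj]; simp)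
      (fun j => by rw [hg.extend_apply])
  rw [e2]
  refine le_trans ?_ h
  have := Finset.sum_le_sum_of_subset_of_nonneg (Finset.subset_univ (Finset.univ.map ⟨f, hf⟩))
      (f := fun i => ‖∑ j, A i j * Function.extend g x 0 j‖ ^ 2) (fun _ _ _ => sq_nonneg _)
  simpa [← e1] using this

section schatten

/-- The Schatten class `S_d^1`, as a space of matrices. -/
def Schatten1 (d : ℕ) : Type := Matrix (Fin d) (Fin d) ℂ

instance (d : ℕ) : AddCommGroup (Schatten1 d) :=
  inferInstanceAs (AddCommGroup (Matrix (Fin d) (Fin d) ℂ))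

noncomputable instance (d : ℕ) : Module ℂ (Schatten1 d) :=
  inferInstanceAs (Module ℂ (Matrix (Fin d) (Fin d) ℂ))

/-- The map `B ↦ (tr (A r s * B))` defined by a matrix `A ∈ M_p(M_d)`. -/
noncomputable def tracePairing {d p : ℕ} (A : Matrix (Fin p × Fin d) (Fin p × Fin d) ℂ) :
    Matrix (Fin d) (Fin d) ℂ →ₗ[ℂ] Matrix (Fin p) (Fin p) ℂ where
  toFun B := Matrix.of fun r s => Matrix.trace (A.submatrix (Prod.mk r) (Prod.mk s) * B)
  map_add' B C := by
    ext r s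
    simp [Matrix.mul_add, Matrix.trace_add]
  map_smul' c B := by
    ext r s
    simp [Matrix.trace_smul]

theorem opNorm_tracePairing_le {d p : ℕ} {A : Matrix (Fin p × Fin d) (Fin p × Fin d) ℂ}
    (hA : opNorm A ≤ 1) (B : Matrix (Fin d) (Fin d) ℂ) :
    opNorm (tracePairing A B) ≤ ∑ a, ∑ b, ‖B b a‖ := by
  have e : tracePairing A B = ∑ a, ∑ b, B b a • A.submatrix (fun r => (r, a)) (fun s => (s, b)) := by
    ext r s
    simp [tracePairing, Matrix.trace, Matrix.mul_apply, Matrix.sum_apply, mul_comm]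
  rw [e]
  refine (opNorm_sum_le _ _).trans (Finset.sum_le_sum fun a _ =>
    (opNorm_sum_le _ _).trans (Finset.sum_le_sum fun b _ => ?_))
  rw [opNorm_smul]
  exact mul_le_of_le_one_right (norm_nonneg _) ((opNorm_submatrix_le A
    (fun _ _ h => (Prod.mk.inj h).1) (fun _ _ h => (Prod.mk.inj h).1)).trans hA)

/-- `S_d^1` as the operator space dual of `M_d` for the trace pairing: the norm of `(B i j)` is
the completely bounded norm of `A ↦ (tr (A * B i j))`, the supremum of
`‖(tr (A r s * B i j))‖` over all `p` and all `A` in the unit ball of `M_p(M_d)`. -/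
noncomputable instance (d : ℕ) : PreOperatorSpace (Schatten1 d) :=
  PreOperatorSpace.ofMaps
    (ι := Σ p : ℕ, {A : Matrix (Fin p × Fin d) (Fin p × Fin d) ℂ // opNorm A ≤ 1})
    (fun i => i.1) (fun i => tracePairing i.2.1)
    (fun _ => ⟨_, fun i => opNorm_tracePairing_le i.2.2 _⟩)

/-- The vector-valued Schatten class `S_d^1(E) = S_d^1 ⊗^ E`, as the space of `d × d` matrices
with entries in `E`. -/
def Schatten1V (d : ℕ) (E : Type*) : Type _ := Matrix (Fin d) (Fin d) E

variable (d : ℕ) (E : Type*) [AddCommGroup E] [Module ℂ E]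

instance : AddCommGroup (Schatten1V d E) :=
  inferInstanceAs (AddCommGroup (Matrix (Fin d) (Fin d) E))

noncomputable instance : Module ℂ (Schatten1V d E) :=
  inferInstanceAs (Module ℂ (Matrix (Fin d) (Fin d) E))

/-- The matrix unit `e_ij`. -/
def Schatten1.unit {d : ℕ} (i j : Fin d) : Schatten1 d := Matrix.single i j (1 : ℂ)

/-- The identification `x ↦ ∑ e_ij ⊗ x_ij` of `M_d(E)` with `M_d ⊗ E`. -/
noncomputable def matrixToTensor :
    Matrix (Fin d) (Fin d) E →ₗ[ℂ] TensorProduct ℂ (Schatten1 d) E where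
  toFun x := ∑ i, ∑ j, TensorProduct.tmul ℂ (Schatten1.unit i j) (x i j)
  map_add' x y := by
    simp only [Matrix.add_apply, TensorProduct.tmul_add, Finset.sum_add_distrib]
  map_smul' c x := by
    simp only [Matrix.smul_apply, TensorProduct.tmul_smul, Finset.smul_sum, RingHom.id_apply]

noncomputable instance [PreOperatorSpace E] : PreOperatorSpace (Schatten1V d E) :=
  PreOperatorSpace.comap (matrixToTensor d E)

end schatten

section ell1

variable {I : Type*} (w : I → NNReal) (X : I → Type*) [∀ i, AddCommGroup (X i)]
  [∀ i, Module ℂ (X i)] [∀ i, PreOperatorSpace (X i)]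

/-- The weighted `ℓ¹`-sum of operator spaces: the families with `∑ i, w i * ‖x i‖ < ∞`. -/
def ell1 : Submodule ℂ (∀ i, X i) where
  carrier := {x | Summable fun i => (w i : ℝ) * vnorm (x i)}
  zero_mem' := by simp [vnorm_zero, summable_zero]
  add_mem' {x y} hx hy := by
    refine Summable.of_nonneg_of_le (fun i => mul_nonneg (w i).coe_nonneg (apply_nonneg _ _))
      (fun i => ?_) (Summable.add hx hy)
    rw [← mul_add]
    exact mul_le_mul_of_nonneg_left (vnorm_add_le _ _) (w i).coe_nonneg
  smul_mem' c x hx := by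
    have := Summable.mul_left ‖c‖ hx
    refine this.congr fun i => ?_
    rw [Pi.smul_apply, vnorm_smul]
    ring

variable {w X}

theorem vnorm_nonneg {V : Type*} [AddCommGroup V] [Module ℂ V] [PreOperatorSpace V] (x : V) :
    0 ≤ vnorm x := apply_nonneg _ _

theorem summable_entry {m : ℕ} {φ : ∀ i, X i →ₗ[ℂ] Matrix (Fin m) (Fin m) ℂ}
    (hφ : ∀ i, IsCompleteContraction (φ i)) (x : ell1 w X) (a b : Fin m) :
    Summable fun i => ((w i : ℝ) : ℂ) * φ i (x.1 i) a b := by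
  refine Summable.of_norm_bounded x.2 fun i => ?_
  rw [norm_mul, Complex.norm_real, Real.norm_of_nonneg (w i).coe_nonneg]
  exact mul_le_mul_of_nonneg_left ((norm_entry_le _ _ _).trans ((hφ i).opNorm_le _)) (w i).coe_nonneg

/-- The map `x ↦ ∑ i, w i * φ i (x i)` defined by complete contractions `φ i : X i → M_m`. -/
noncomputable def sumMap {m : ℕ} (φ : ∀ i, X i →ₗ[ℂ] Matrix (Fin m) (Fin m) ℂ)
    (hφ : ∀ i, IsCompleteContraction (φ i)) : ell1 w X →ₗ[ℂ] Matrix (Fin m) (Fin m) ℂ where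
  toFun x := Matrix.of fun a b => ∑' i, ((w i : ℝ) : ℂ) * φ i (x.1 i) a b
  map_add' x y := by
    ext a b
    have := (summable_entry hφ x a b).tsum_add (summable_entry hφ y a b)
    simpa [mul_add] using this
  map_smul' c x := by
    ext a b
    have := (summable_entry hφ x a b).tsum_mul_left c
    simpa [mul_left_comm] using this

theorem opNorm_sumMap_le {m : ℕ} (φ : ∀ i, X i →ₗ[ℂ] Matrix (Fin m) (Fin m) ℂ)
    (hφ : ∀ i, IsCompleteContraction (φ i)) (x : ell1 w X) :
    opNorm (sumMap φ hφ x) ≤ ∑' i, (w i : ℝ) * vnorm (x.1 i) := by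
  have h0 : ∀ i, 0 ≤ (w i : ℝ) * vnorm (x.1 i) := fun i => mul_nonneg (w i).coe_nonneg (vnorm_nonneg _)
  refine opNorm_le (tsum_nonneg h0) fun z => ?_
  let F : Finset I → Matrix (Fin m) (Fin m) ℂ := fun s => ∑ i ∈ s, ((w i : ℝ) : ℂ) • φ i (x.1 i)
  have hF : ∀ s, opNorm (F s) ≤ ∑' i, (w i : ℝ) * vnorm (x.1 i) := fun s => by
    refine (opNorm_sum_le _ _).trans (le_trans (Finset.sum_le_sum fun i _ => ?_)
      (x.2.sum_le_tsum s fun i _ => h0 i))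
    rw [opNorm_smul, Complex.norm_real, Real.norm_of_nonneg (w i).coe_nonneg]
    exact mul_le_mul_of_nonneg_left ((hφ i).opNorm_le _) (w i).coe_nonneg
  have ht : ∀ a b, Filter.Tendsto (fun s => F s a b) Filter.atTop
      (nhds (sumMap φ hφ x a b)) := fun a b => by
    have := (summable_entry hφ x a b).hasSum
    simpa [HasSum, F, Matrix.sum_apply, sumMap] using this
  have ht2 : Filter.Tendsto (fun s => ∑ a, ‖∑ b, F s a b * z b‖ ^ 2) Filter.atTop
      (nhds (∑ a, ‖∑ b, sumMap φ hφ x a b * z b‖ ^ 2)) :=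
    tendsto_finsetSum _ fun a _ => ((tendsto_finsetSum _ fun b _ =>
      (ht a b).mul_const (z b)).norm).pow 2
  refine le_of_tendsto' ht2 fun s => (sum_mulVec_le (F s) z).trans ?_
  have := opNorm_nonneg (F s)
  have := hF s
  gcongr

/-- The operator space structure of the `ℓ¹`-sum, for which completely contractive maps
`ell1 w X → M_m` are the maps `∑ i, w i * φ i` with complete contractions `φ i : X i → M_m`:
the norm of `(x k l)` is the supremum of `‖(∑ i, w i * φ i (x k l i))‖` over all `m` and all such
families; in other words, `ell1 w X` is embedded in the dual of the `ℓ^∞`-sum of the duals. -/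
noncomputable instance : PreOperatorSpace (ell1 w X) :=
  PreOperatorSpace.ofMaps
    (ι := Σ m : ℕ, {φ : ∀ i, X i →ₗ[ℂ] Matrix (Fin m) (Fin m) ℂ //
      ∀ i, IsCompleteContraction (φ i)})
    (fun j => j.1) (fun j => sumMap j.2.1 j.2.2)
    (fun x => ⟨_, fun j => opNorm_sumMap_le j.2.1 j.2.2 x⟩)

/-- A linear functional bounded by the norm is completely contractive. -/
theorem isCompleteContraction_of_functional {V : Type*} [AddCommGroup V] [Module ℂ V]
    [PreOperatorSpace V] (f : V →ₗ[ℂ] ℂ) (hf : ∀ v, ‖f v‖ ≤ vnorm v)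
    (φ : V →ₗ[ℂ] Matrix (Fin 1) (Fin 1) ℂ) (hφ : ∀ v i j, φ v i j = f v) :
    IsCompleteContraction φ := by
  intro n x
  set N := PreOperatorSpace.mnorm n x
  have hN : 0 ≤ N := apply_nonneg _ _
  refine opNorm_le hN fun z => ?_
  simp only [Fintype.sum_prod_type, Fin.sum_univ_one, amp, Matrix.of_apply, hφ]
  set t : Fin n → ℂ := fun j => z (j, 0) with ht
  set y : Fin n → ℂ := fun i => ∑ j, f (x i j) * z (j, 0) with hy
  change ∑ i, ‖y i‖ ^ 2 ≤ N ^ 2 * ∑ j, ‖t j‖ ^ 2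
  set Y := ∑ i, ‖y i‖ ^ 2 with hY
  set Z := ∑ j, ‖t j‖ ^ 2 with hZ
  have hY0 : 0 ≤ Y := Finset.sum_nonneg fun _ _ => sq_nonneg _
  have hZ0 : 0 ≤ Z := Finset.sum_nonneg fun _ _ => sq_nonneg _
  let R : Matrix (Fin 1) (Fin n) ℂ := Matrix.of fun _ i => star (y i)
  let C : Matrix (Fin n) (Fin 1) ℂ := Matrix.of fun j _ => t j
  have hR : opNorm R ≤ Real.sqrt Y := by
    refine opNorm_le (Real.sqrt_nonneg _) fun u => ?_
    rw [Real.sq_sqrt hY0, Fin.sum_univ_one]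
    have h1 : ‖∑ i, R 0 i * u i‖ ≤ ∑ i, ‖y i‖ * ‖u i‖ :=
      (norm_sum_le _ _).trans (le_of_eq (by simp [R]))
    exact (pow_le_pow_left₀ (norm_nonneg _) h1 2).trans (Finset.sum_mul_sq_le_sq_mul_sq _ _ _)
  have hC : opNorm C ≤ Real.sqrt Z := by
    refine opNorm_le (Real.sqrt_nonneg _) fun u => ?_
    rw [Real.sq_sqrt hZ0, Fin.sum_univ_one, Finset.sum_mul]
    simp [C, mul_pow]
  have h1 : bimod R x C = Matrix.of fun _ _ => ∑ i, ∑ j, (star (y i) * t j) • x i j := rfl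
  have h2 : f (∑ i, ∑ j, (star (y i) * t j) • x i j) = (Y : ℂ) := by
    simp only [map_sum, map_smul, smul_eq_mul]
    rw [hY, Complex.ofReal_sum]
    refine Finset.sum_congr rfl fun i _ => ?_
    have : ∑ j, star (y i) * t j * f (x i j) = star (y i) * y i := by
      rw [hy, Finset.mul_sum]
      exact Finset.sum_congr rfl fun j _ => by rw [ht]; ring
    rw [this, Complex.star_def, Complex.conj_mul', Complex.ofReal_pow]
  have h3 : Y ≤ Real.sqrt Y * N * Real.sqrt Z := by
    have h4 := hf (∑ i, ∑ j, (star (y i) * t j) • x i j)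
    rw [h2, Complex.norm_real, Real.norm_of_nonneg hY0] at h4
    refine h4.trans ?_
    unfold vnorm
    rw [← h1]
    refine (PreOperatorSpace.mnorm_bimod_le R x C).trans ?_
    have := opNorm_nonneg C
    gcongr
  have h5 : Real.sqrt Y ≤ N * Real.sqrt Z := by
    rcases hY0.eq_or_lt with h | h
    · rw [← h, Real.sqrt_zero]; positivity
    · have h6 : 0 < Real.sqrt Y := Real.sqrt_pos.2 h
      nlinarith [Real.mul_self_sqrt hY0]
  calc Y = Real.sqrt Y ^ 2 := (Real.sq_sqrt hY0).symm
    _ ≤ (N * Real.sqrt Z) ^ 2 := by gcongr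
    _ = N ^ 2 * Z := by rw [mul_pow, Real.sq_sqrt hZ0]

theorem exists_functional {V : Type*} [AddCommGroup V] [Module ℂ V] [PreOperatorSpace V] (v : V) :
    ∃ f : V →ₗ[ℂ] ℂ, (∀ u, ‖f u‖ ≤ vnorm u) ∧ f v = (vnorm v : ℂ) := by
  obtain ⟨g, hg, hv⟩ := exists_dual_vector'' ℂ (E := AsSeminormed V) v
  exact ⟨g.toLinearMap, fun u => (g.le_of_opNorm_le hg u).trans_eq (one_mul _), hv⟩

/-- The norm of the `ℓ¹`-sum is `∑ i, w i * ‖x i‖`. -/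
theorem vnorm_ell1 (x : ell1 w X) : vnorm x = ∑' i, (w i : ℝ) * vnorm (x.1 i) := by
  let J := Σ m : ℕ, {φ : ∀ i, X i →ₗ[ℂ] Matrix (Fin m) (Fin m) ℂ //
      ∀ i, IsCompleteContraction (φ i)}
  have hx : ∀ j : J, opNorm (amp (sumMap j.2.1 j.2.2) (Matrix.of fun _ _ : Fin 1 => x)) ≤
      ∑' i, (w i : ℝ) * vnorm (x.1 i) := fun j =>
    (opNorm_amp_le _ _).trans (by simpa using opNorm_sumMap_le j.2.1 j.2.2 x)
  have h0 : 0 ≤ ∑' i, (w i : ℝ) * vnorm (x.1 i) :=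
    tsum_nonneg fun i => mul_nonneg (w i).coe_nonneg (vnorm_nonneg _)
  refine le_antisymm (Real.iSup_le hx h0) ?_
  choose f hf hfx using fun i => exists_functional (x.1 i)
  let φ : ∀ i, X i →ₗ[ℂ] Matrix (Fin 1) (Fin 1) ℂ := fun i =>
    { toFun := fun v => Matrix.of fun _ _ => f i v
      map_add' := fun u v => by ext; simp
      map_smul' := fun c v => by ext; simp }
  have hφ : ∀ i, IsCompleteContraction (φ i) := fun i =>
    isCompleteContraction_of_functional (f i) (hf i) (φ i) fun _ _ _ => rfl
  refine le_trans ?_ (le_ciSup (f := fun j : J =>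
    opNorm (amp (sumMap j.2.1 j.2.2) (Matrix.of fun _ _ : Fin 1 => x)))
    ⟨_, by rintro _ ⟨j, rfl⟩; exact hx j⟩ ⟨1, φ, hφ⟩)
  refine le_trans (le_of_eq ?_) (norm_entry_le _ (0, 0) (0, 0))
  have : sumMap φ hφ x 0 0 = ((∑' i, (w i : ℝ) * vnorm (x.1 i) : ℝ) : ℂ) := by
    rw [Complex.ofReal_tsum]
    refine tsum_congr fun i => ?_
    rw [Complex.ofReal_mul, ← hfx]
    rfl
  change _ = ‖sumMap φ hφ x 0 0‖
  rw [this, Complex.norm_real, Real.norm_of_nonneg h0]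

end ell1

section dualObject

variable (G : Type*) [Group G] [TopologicalSpace G]

/-- The continuous irreducible unitary representations of `G` on the spaces `ℂ^dim`. -/
structure IrrepUnitary where
  dim : ℕ
  rep : G →* Matrix.unitaryGroup (Fin dim) ℂ
  continuous_rep : Continuous rep
  dim_pos : 0 < dim
  irreducible : ∀ S : Submodule ℂ (Fin dim → ℂ),
    (∀ g, ∀ v ∈ S, Matrix.mulVec (rep g : Matrix (Fin dim) (Fin dim) ℂ) v ∈ S) →
    S = ⊥ ∨ S = ⊤

variable {G}

/-- Unitary equivalence of representations. -/
def IrrepUnitary.Equivalent (π ρ : IrrepUnitary G) : Prop :=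
  ∃ T : Matrix (Fin π.dim) (Fin ρ.dim) ℂ, T * T.conjTranspose = 1 ∧ T.conjTranspose * T = 1 ∧
    ∀ g, (π.rep g : Matrix (Fin π.dim) (Fin π.dim) ℂ) * T =
      T * (ρ.rep g : Matrix (Fin ρ.dim) (Fin ρ.dim) ℂ)

theorem IrrepUnitary.Equivalent.dim_eq {π ρ : IrrepUnitary G} (h : π.Equivalent ρ) :
    π.dim = ρ.dim := by
  obtain ⟨T, h1, h2, -⟩ := h
  have := Matrix.trace_mul_comm T T.conjTranspose
  rw [h1, h2, Matrix.trace_one, Matrix.trace_one, Fintype.card_fin, Fintype.card_fin] at this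
  exact_mod_cast this

variable (G) in
instance irrepSetoid : Setoid (IrrepUnitary G) where
  r := IrrepUnitary.Equivalent
  iseqv :=
    { refl := fun π => ⟨1, by simp, by simp, by simp⟩
      symm := by
        rintro π ρ ⟨T, h1, h2, h3⟩
        refine ⟨T.conjTranspose, by simpa using h2, by simpa using h1, fun g => ?_⟩
        calc (ρ.rep g : Matrix (Fin ρ.dim) (Fin ρ.dim) ℂ) * T.conjTranspose
            = T.conjTranspose * (T * (ρ.rep g : Matrix (Fin ρ.dim) (Fin ρ.dim) ℂ)) * T.conjTranspose := by
              rw [← Matrix.mul_assoc, h2, Matrix.one_mul]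
          _ = T.conjTranspose * (π.rep g : Matrix (Fin π.dim) (Fin π.dim) ℂ) := by
              rw [← h3, Matrix.mul_assoc, Matrix.mul_assoc, h1, Matrix.mul_one]
      trans := by
        rintro π ρ σ ⟨T, h1, h2, h3⟩ ⟨S, k1, k2, k3⟩
        refine ⟨T * S, ?_, ?_, fun g => ?_⟩
        · rw [Matrix.conjTranspose_mul, Matrix.mul_assoc, ← Matrix.mul_assoc S, k1,
            Matrix.one_mul, h1]
        · rw [Matrix.conjTranspose_mul, Matrix.mul_assoc, ← Matrix.mul_assoc _ T, h2,
            Matrix.one_mul, k2]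
        · rw [← Matrix.mul_assoc, h3, Matrix.mul_assoc, k3, Matrix.mul_assoc] }

variable (G) in
/-- The dual object of `G`: the classes of irreducible unitary representations. -/
def DualObject : Type _ := Quotient (irrepSetoid G)

/-- The degree of (the representations in) an element of the dual object. -/
def DualObject.degree (π : DualObject G) : ℕ :=
  Quotient.lift IrrepUnitary.dim (fun _ _ h => IrrepUnitary.Equivalent.dim_eq h) π

variable (G) in
/-- The space of families `A` of matrices `A π ∈ S_d^1(E)`, `d = degree π`, with
`∑ π, degree π * ‖A π‖ < ∞`. -/
abbrev DualL1 (E : Type*) [AddCommGroup E] [Module ℂ E] [PreOperatorSpace E] : Type _ :=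
  ell1 (fun π : DualObject G => (π.degree : NNReal)) (fun π => Schatten1V π.degree E)

end dualObject

end OpSp

/-! The norms on both sides can be tested by complete contractions into matrix algebras, and the two
families of tests coincide. On an `ell1` sum of spaces `Y i` the tests are by definition the maps
`sumMap φ`, for families of complete contractions `φ i : Y i → M_m`. On the algebraic tensor product
the norm is an infimum over factorizations, and Ruan's theorem
(`mnorm_le_of_forall_isCompleteContraction`) recovers it from the complete contractions `Ψ` into
matrix algebras. These are exactly the jointly completely contractive bilinear maps
(`isCompleteContraction_of_kron`, `IsCompleteContraction.opNorm_kron_le`).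

Let `Y i` be identified with `X i ⊗ E`. A family `φ` on the `Y i`, sliced by a matrix `u` over `E`,
becomes a family on the `X i`, which is a test for the norm of `ell1 w X`; so `φ` induces a complete
contraction on `ell1 w X ⊗ E` (`isCompleteContraction_sumMap_comp_ell1Tensor`). Conversely,
restricting `Ψ` to the `i`-th summand and dividing by the weight gives `φ i`, and `Ψ` is recovered
from these because finitely supported families are dense in `ℓ¹` (`exists_sumMap_eq`). Hence
`isCompleteIsometry_ell1Tensor`.

Ruan's theorem is proved in the usual way. A norming functional `F` on `M_n(Z)` is dominated by two
positive functionals, by Hahn–Banach separation (`exists_states`). After adding `ε` times the trace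
these have the form `‖Sα‖²` and `‖Tα‖²` in the Hilbert–Schmidt norm, with `S` and `T` invertible
(`exists_isUnit_factor`). Multiplying the matrix `(F (e_i v e_j))` by the inverses on either side
gives a complete contraction into `M_n` that norms the given matrix up to a factor `1 + ε n`.

It remains to identify `S_d^1(ℂ) ⊗ E` with `S_d^1(E)`, which rests on `V ⊗ ℂ = V` (`mnorm_map_rid`),
and to pass to the completion. The target is complete: the norm of `S_d^1(E)` is equivalent to the
sum of the norms of the entries, and weighted `ℓ¹`-sums preserve completeness. So the isometry
extends from the algebraic tensor product. -/

namespace OpSp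

/-! ### Positive functionals on matrices, and criteria for the operator norm -/

/-- A real functional on matrices is the real part of a trace functional. -/
theorem exists_re_trace {n : ℕ} (p : Matrix (Fin n) (Fin n) ℂ →ₗ[ℝ] ℝ) :
    ∃ M : Matrix (Fin n) (Fin n) ℂ, ∀ A, p A = (M * A).trace.re := by
  refine ⟨Matrix.of fun j i => (p (Matrix.single i j 1) : ℂ) -
    (p (Matrix.single i j Complex.I) : ℂ) * Complex.I, fun A => ?_⟩
  have e : ∀ i j, Matrix.single i j (A i j) = (A i j).re • Matrix.single i j (1 : ℂ) +
      (A i j).im • Matrix.single i j Complex.I := fun i j => by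
    rw [Matrix.smul_single, Matrix.smul_single, ← Matrix.single_add]
    congr 1
    simp [Complex.re_add_im]
  conv_lhs => rw [Matrix.matrix_eq_sum_single A]
  simp only [map_sum, e, map_add, map_smul, smul_eq_mul, Matrix.trace, Matrix.diag_apply,
    Matrix.mul_apply, Matrix.of_apply, Complex.re_sum]
  rw [Finset.sum_comm]
  refine Finset.sum_congr rfl fun j _ => Finset.sum_congr rfl fun i _ => ?_
  simp
  ring

open Matrix in
theorem re_trace_conjTranspose_mul_self {m n : Type*} [Fintype m] [Fintype n]
    (A : Matrix m n ℂ) : (Aᴴ * A).trace.re = ∑ i, ∑ j, ‖A i j‖ ^ 2 := by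
  simp only [Matrix.trace, Matrix.diag_apply, Matrix.mul_apply, Complex.re_sum,
    Matrix.conjTranspose_apply, Complex.star_def, Complex.conj_mul']
  rw [Finset.sum_comm]
  exact Finset.sum_congr rfl fun i _ => Finset.sum_congr rfl fun j _ => by norm_cast

open Matrix MatrixOrder ComplexOrder Matrix.Norms.L2Operator in
/-- A positive functional, perturbed by a multiple of the trace, is given by an invertible
matrix. -/
theorem exists_isUnit_factor {n : ℕ} (p : Matrix (Fin n) (Fin n) ℂ →ₗ[ℝ] ℝ)
    (hp : ∀ α : Matrix (Fin n) (Fin 1) ℂ, 0 ≤ p (α * αᴴ)) {ε : ℝ} (hε : 0 < ε) :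
    ∃ S : Matrix (Fin n) (Fin n) ℂ, IsUnit S.det ∧
      ∀ (r : ℕ) (α : Matrix (Fin n) (Fin r) ℂ),
        ∑ i, ∑ k, ‖(S * α) i k‖ ^ 2 = p (α * αᴴ) + ε * ∑ i, ∑ k, ‖α i k‖ ^ 2 := by
  obtain ⟨N, hN⟩ := exists_re_trace p
  -- Only the Hermitian part of `N` is seen by the matrices `α αᴴ`. The term `ε • 1` makes `M`
  -- strictly positive, so that the factor `S` in `M = Sᴴ S` is invertible.
  set M : Matrix (Fin n) (Fin n) ℂ := (2⁻¹ : ℂ) • (N + Nᴴ) + (ε : ℂ) • 1 with hM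
  have hMh : M.IsHermitian := by
    rw [Matrix.IsHermitian, hM]
    simp [add_comm]
  have key : ∀ (r : ℕ) (α : Matrix (Fin n) (Fin r) ℂ),
      (αᴴ * M * α).trace.re = p (α * αᴴ) + ε * ∑ i, ∑ k, ‖α i k‖ ^ 2 := by
    intro r α
    have h1 : (αᴴ * Nᴴ * α).trace.re = (αᴴ * N * α).trace.re := by
      have : αᴴ * Nᴴ * α = (αᴴ * N * α)ᴴ := by
        simp [Matrix.conjTranspose_mul, Matrix.mul_assoc]
      rw [this, Matrix.trace_conjTranspose]
      simp
    have h2 : (αᴴ * N * α).trace.re = p (α * αᴴ) := by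
      rw [hN, Matrix.mul_assoc, Matrix.trace_mul_comm, Matrix.mul_assoc]
    have h3 : αᴴ * M * α = (2⁻¹ : ℂ) • (αᴴ * N * α + αᴴ * Nᴴ * α) + (ε : ℂ) • (αᴴ * α) := by
      rw [hM]
      simp [Matrix.mul_add, Matrix.add_mul]
    rw [h3, Matrix.trace_add, Matrix.trace_smul, Matrix.trace_smul, Matrix.trace_add,
      Complex.add_re, smul_eq_mul, smul_eq_mul, Complex.re_ofReal_mul,
      re_trace_conjTranspose_mul_self, show (2⁻¹ : ℂ) = ((2⁻¹ : ℝ) : ℂ) by simp,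
      Complex.re_ofReal_mul, Complex.add_re, h1, h2]
    ring
  have hpos : M.PosDef := by
    refine Matrix.PosDef.of_dotProduct_mulVec_pos hMh fun a ha => ?_
    have e : ((Matrix.replicateCol (Fin 1) a)ᴴ * M * Matrix.replicateCol (Fin 1) a).trace =
        star a ⬝ᵥ (M *ᵥ a) := by
      simp [Matrix.trace, Matrix.mul_apply, dotProduct, Matrix.mulVec, Finset.mul_sum,
        Finset.sum_mul, mul_assoc]
      rw [Finset.sum_comm]
    rw [Complex.pos_iff]
    refine ⟨?_, ?_⟩
    · rw [← e, key]
      refine add_pos_of_nonneg_of_pos (hp _) (mul_pos hε ?_)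
      obtain ⟨i, hi⟩ := Function.ne_iff.1 ha
      refine Finset.sum_pos' (fun _ _ => by positivity) ⟨i, Finset.mem_univ _, ?_⟩
      have := norm_pos_iff.2 hi
      simp only [Finset.univ_unique, Matrix.replicateCol_apply, Finset.sum_const,
        Finset.card_singleton, one_smul]
      positivity
    · have := hMh.im_star_dotProduct_mulVec_self a
      simpa using this.symm
  obtain ⟨S, hS⟩ := CStarAlgebra.nonneg_iff_eq_star_mul_self.mp hpos.posSemidef.nonneg
  have hS' : M = Sᴴ * S := hS
  refine ⟨S, ?_, fun r α => ?_⟩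
  · have := (Matrix.isUnit_iff_isUnit_det _).1 hpos.isUnit
    rw [hS', Matrix.det_mul] at this
    exact isUnit_of_mul_isUnit_right this
  · rw [← key, ← re_trace_conjTranspose_mul_self, hS']
    simp [Matrix.conjTranspose_mul, Matrix.mul_assoc]

open Matrix in
theorem opNorm_mul_conjTranspose {m n : Type*} [Fintype m] [Fintype n] [DecidableEq m]
    [DecidableEq n] (A : Matrix m n ℂ) : opNorm (A * Aᴴ) = opNorm A * opNorm A := by
  have h := Matrix.l2_opNorm_conjTranspose_mul_self Aᴴ
  rw [Matrix.conjTranspose_conjTranspose, Matrix.l2_opNorm_conjTranspose] at h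
  exact h

open Matrix in
theorem opNorm_conjTranspose_mul {m n : Type*} [Fintype m] [Fintype n] [DecidableEq m]
    [DecidableEq n] (A : Matrix m n ℂ) : opNorm (Aᴴ * A) = opNorm A * opNorm A :=
  Matrix.l2_opNorm_conjTranspose_mul_self A

/-- Taking for `y` the conjugate of `A x` gives `2 ‖A x‖² ≤ ‖A x‖² + ‖x‖²`. This additive form of
contractivity is what domination by a pair of states provides. -/
theorem opNorm_le_one_of_re {m n : Type*} [Fintype m] [Fintype n] [DecidableEq m] [DecidableEq n]
    {A : Matrix m n ℂ} (h : ∀ (y : m → ℂ) (x : n → ℂ),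
      2 * (∑ i, ∑ j, y i * A i j * x j).re ≤ ∑ i, ‖y i‖ ^ 2 + ∑ j, ‖x j‖ ^ 2) :
    opNorm A ≤ 1 := by
  refine opNorm_le zero_le_one fun x => ?_
  have h1 := h (fun i => star (∑ j, A i j * x j)) x
  have e : (∑ i, ∑ j, star (∑ j, A i j * x j) * A i j * x j).re =
      ∑ i, ‖∑ j, A i j * x j‖ ^ 2 := by
    rw [Complex.re_sum]
    refine Finset.sum_congr rfl fun i _ => ?_
    simp only [mul_assoc]
    rw [← Finset.mul_sum, Complex.star_def, Complex.conj_mul']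
    norm_cast
  simp only [e, norm_star] at h1
  linarith


/-! ### Domination of functionals on `M_n(Z)` by states -/

section ruan

variable {Z : Type*} [AddCommGroup Z] [Module ℂ Z] [PreOperatorSpace Z]

/-- Hahn–Banach in `M_n(Z)`, viewed as a seminormed space under its own matrix seminorm. -/
theorem exists_matrix_functional {n : ℕ} (x : Matrix (Fin n) (Fin n) Z) :
    ∃ F : Matrix (Fin n) (Fin n) Z →ₗ[ℂ] ℂ, (∀ y, ‖F y‖ ≤ PreOperatorSpace.mnorm n y) ∧
      F x = (PreOperatorSpace.mnorm n x : ℂ) := by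
  let s := (PreOperatorSpace.mnorm (V := Z) n)
  let i : SeminormedAddCommGroup (Matrix (Fin n) (Fin n) Z) :=
    s.toAddGroupSeminorm.toSeminormedAddCommGroup
  let k : NormedSpace ℂ (Matrix (Fin n) (Fin n) Z) :=
    { norm_smul_le := fun c y => (map_smul_eq_mul s c y).le }
  obtain ⟨g, hg, hx⟩ := exists_dual_vector'' ℂ x
  exact ⟨g.toLinearMap, fun u => (g.le_of_opNorm_le hg u).trans_eq (one_mul _), hx⟩

/-- The points `(α α*, β* β, 2 Re F(α v β))` for `v` in the unit ball of `M_r(Z)`. -/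
def ruanCone {n : ℕ} (F : Matrix (Fin n) (Fin n) Z →ₗ[ℂ] ℂ) :
    Set (Matrix (Fin n) (Fin n) ℂ × Matrix (Fin n) (Fin n) ℂ × ℝ) :=
  {d | ∃ (r : ℕ) (α : Matrix (Fin n) (Fin r) ℂ) (v : Matrix (Fin r) (Fin r) Z)
    (β : Matrix (Fin r) (Fin n) ℂ), PreOperatorSpace.mnorm r v ≤ 1 ∧
    d = (α * α.conjTranspose, β.conjTranspose * β, 2 * (F (bimod α v β)).re)}

/-- Use the row `(α α')`, the block sum `v ⊕ v'` and the column of `β` and `β'`: all three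
coordinates add up. Ruan's axiom on direct sums keeps `v ⊕ v'` in the unit ball, and this is why the
set is convex. -/
theorem ruanCone_add {n : ℕ} {F : Matrix (Fin n) (Fin n) Z →ₗ[ℂ] ℂ} {d d'}
    (h : d ∈ ruanCone F) (h' : d' ∈ ruanCone F) : d + d' ∈ ruanCone F := by
  obtain ⟨r, α, v, β, hv, rfl⟩ := h
  obtain ⟨r', α', v', β', hv', rfl⟩ := h'
  refine ⟨r + r', Matrix.of fun i => Fin.addCases (α i) (α' i), dsum v v',
    Matrix.of fun k j => Fin.addCases (fun k => β k j) (fun k => β' k j) k,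
    (PreOperatorSpace.mnorm_dsum_le _ _).trans (max_le hv hv'), ?_⟩
  simp only [Prod.mk_add_mk, Prod.mk.injEq]
  refine ⟨?_, ?_, ?_⟩
  · ext i j
    simp [Matrix.mul_apply, Fin.sum_univ_add, -Fin.natAdd_eq_addNat]
  · ext i j
    simp [Matrix.mul_apply, Fin.sum_univ_add, -Fin.natAdd_eq_addNat]
  · rw [← mul_add, ← Complex.add_re, ← map_add]
    congr 3
    ext i j
    simp [bimod, Fin.sum_univ_add, -Fin.natAdd_eq_addNat]

/-- All three coordinates are of degree two in the pair `(α, β)`, so both are scaled by `√t`. -/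
theorem ruanCone_smul {n : ℕ} {F : Matrix (Fin n) (Fin n) Z →ₗ[ℂ] ℂ} {d}
    (h : d ∈ ruanCone F) {t : ℝ} (ht : 0 ≤ t) : t • d ∈ ruanCone F := by
  obtain ⟨r, α, v, β, hv, rfl⟩ := h
  have hs : ((Real.sqrt t : ℝ) : ℂ) * (Real.sqrt t : ℝ) = t := by
    rw [← Complex.ofReal_mul, Real.mul_self_sqrt ht]
  have hr : ∀ A : Matrix (Fin n) (Fin n) ℂ, t • A = (t : ℂ) • A := fun A => by
    ext; simp
  refine ⟨r, ((Real.sqrt t : ℝ) : ℂ) • α, v, ((Real.sqrt t : ℝ) : ℂ) • β, hv, ?_⟩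
  simp only [Prod.smul_mk, Prod.mk.injEq]
  refine ⟨?_, ?_, ?_⟩
  · rw [hr, Matrix.conjTranspose_smul, Matrix.smul_mul, Matrix.mul_smul, smul_smul,
      Complex.star_def, Complex.conj_ofReal, hs]
  · rw [hr, Matrix.conjTranspose_smul, Matrix.smul_mul, Matrix.mul_smul, smul_smul,
      Complex.star_def, Complex.conj_ofReal, hs]
  · have : bimod (((Real.sqrt t : ℝ) : ℂ) • α) v (((Real.sqrt t : ℝ) : ℂ) • β) =
        (t : ℂ) • bimod α v β := by
      ext i j
      simp only [bimod, Matrix.smul_apply, Finset.smul_sum, smul_smul, smul_eq_mul, ← hs]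
      exact Finset.sum_congr rfl fun _ _ => Finset.sum_congr rfl fun _ _ => by congr 1; ring
    rw [this, map_smul, smul_eq_mul, smul_eq_mul, Complex.re_ofReal_mul]
    ring

/-- From `|F (α v β)| ≤ ‖α‖ ‖β‖` and `2ab ≤ a² + b²`, with the C*-identity turning the squares into
`‖α α*‖` and `‖β* β‖`. Thus the cone misses the open set where the reverse strict inequality holds.
-/
theorem ruanCone_le {n : ℕ} {F : Matrix (Fin n) (Fin n) Z →ₗ[ℂ] ℂ}
    (hF : ∀ y, ‖F y‖ ≤ PreOperatorSpace.mnorm n y) {d} (h : d ∈ ruanCone F) :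
    d.2.2 ≤ opNorm d.1 + opNorm d.2.1 := by
  obtain ⟨r, α, v, β, hv, rfl⟩ := h
  simp only [opNorm_mul_conjTranspose, opNorm_conjTranspose_mul]
  have h1 := (Complex.re_le_norm _).trans ((hF _).trans (PreOperatorSpace.mnorm_bimod_le α v β))
  have ha := opNorm_nonneg α
  have hb := opNorm_nonneg β
  have h2 : opNorm α * PreOperatorSpace.mnorm r v * opNorm β ≤ opNorm α * 1 * opNorm β := by
    gcongr
  nlinarith [sq_nonneg (opNorm α - opNorm β)]

open Matrix.Norms.L2Operator in
/-- A contractive functional on `M_n(Z)` is dominated by a pair of states. -/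
theorem exists_states {n : ℕ} (F : Matrix (Fin n) (Fin n) Z →ₗ[ℂ] ℂ)
    (hF : ∀ y, ‖F y‖ ≤ PreOperatorSpace.mnorm n y) :
    ∃ p q : Matrix (Fin n) (Fin n) ℂ →ₗ[ℝ] ℝ, p 1 ≤ 1 ∧ q 1 ≤ 1 ∧
      ∀ (r : ℕ) (α : Matrix (Fin n) (Fin r) ℂ) (v : Matrix (Fin r) (Fin r) Z)
        (β : Matrix (Fin r) (Fin n) ℂ), PreOperatorSpace.mnorm r v ≤ 1 →
        2 * (F (bimod α v β)).re ≤ p (α * α.conjTranspose) + q (β.conjTranspose * β) := by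
  let O : Set (Matrix (Fin n) (Fin n) ℂ × Matrix (Fin n) (Fin n) ℂ × ℝ) :=
    {d | ‖d.1‖ + ‖d.2.1‖ < d.2.2}
  have hO : IsOpen O := isOpen_lt (by fun_prop) (by fun_prop)
  have hOc : Convex ℝ O := by
    intro x hx y hy a b ha hb hab
    change ‖a • x.1 + b • y.1‖ + ‖a • x.2.1 + b • y.2.1‖ < a * x.2.2 + b * y.2.2
    have h1 : ‖x.1‖ + ‖x.2.1‖ < x.2.2 := hx
    have h2 : ‖y.1‖ + ‖y.2.1‖ < y.2.2 := hy
    have e1 := norm_add_le (a • x.1) (b • y.1)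
    have e2 := norm_add_le (a • x.2.1) (b • y.2.1)
    simp only [norm_smul, Real.norm_of_nonneg ha, Real.norm_of_nonneg hb] at e1 e2
    -- The strict inequality survives only in a term of positive weight; if `a = 0`, then that
    -- weight is `b = 1`.
    rcases ha.eq_or_lt with h | h
    · have : b = 1 := by linarith
      subst h this
      simp at e1 e2 ⊢
      linarith
    · nlinarith
  have hDc : Convex ℝ (ruanCone F) := fun x hx y hy a b ha hb _ =>
    ruanCone_add (ruanCone_smul hx ha) (ruanCone_smul hy hb)
  have hdisj : Disjoint O (ruanCone F) := Set.disjoint_left.2 fun d hd hd' =>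
    (lt_irrefl _ (lt_of_lt_of_le hd (ruanCone_le hF hd')))
  obtain ⟨f, u, hfO, hfD⟩ := geometric_hahn_banach_open hOc hO hDc hdisj
  have hD0 : (0 : Matrix (Fin n) (Fin n) ℂ × Matrix (Fin n) (Fin n) ℂ × ℝ) ∈ ruanCone F :=
    ⟨0, 0, 0, 0, by simp, by
      have : bimod (0 : Matrix (Fin n) (Fin 0) ℂ) (0 : Matrix (Fin 0) (Fin 0) Z)
          (0 : Matrix (Fin 0) (Fin n) ℂ) = 0 := by
        ext; simp [bimod]
      simp [this]
      rfl⟩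
  have hu : u ≤ 0 := by simpa using hfD 0 hD0
  -- A functional bounded below on a cone is nonnegative there: if `f d < 0`, the multiple of `d`
  -- chosen here has value `u - 1 < u`.
  have hfD' : ∀ d ∈ ruanCone F, 0 ≤ f d := by
    intro d hd
    by_contra! hneg
    have h := hfD _ (ruanCone_smul hd (t := (u - 1) / f d)
      (div_nonneg_of_nonpos (by linarith) hneg.le))
    rw [map_smul, smul_eq_mul, div_mul_cancel₀ _ hneg.ne] at h
    linarith
  -- The separating functional is strictly negative in the direction of the last coordinate, so
  -- dividing by `s` gives that coordinate coefficient `-1`; the other two coordinates then define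
  -- `p` and `q`.
  set s : ℝ := - f (0, 0, 1) with hs
  have hs0 : 0 < s := by
    have : f (0, 0, 1) < u := hfO _ (by simp [O])
    linarith
  have hf : ∀ a b c, f (a, b, c) = f (a, 0, 0) + f (0, b, 0) - c * s := by
    intro a b c
    have : ((a, b, c) : Matrix (Fin n) (Fin n) ℂ × Matrix (Fin n) (Fin n) ℂ × ℝ) =
      (a, 0, 0) + (0, b, 0) + c • (0, 0, 1) := by simp
    rw [this, map_add, map_add, map_smul, hs, smul_eq_mul]
    ring
  have hone : ‖(1 : Matrix (Fin n) (Fin n) ℂ)‖ ≤ 1 := opNorm_one_le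
  let p : Matrix (Fin n) (Fin n) ℂ →ₗ[ℝ] ℝ :=
    s⁻¹ • f.toLinearMap.comp (LinearMap.inl ℝ _ _)
  let q : Matrix (Fin n) (Fin n) ℂ →ₗ[ℝ] ℝ :=
    s⁻¹ • f.toLinearMap.comp ((LinearMap.inr ℝ _ _).comp (LinearMap.inl ℝ _ _))
  have hp : ∀ a, p a = s⁻¹ * f (a, 0, 0) := fun a => rfl
  have hq : ∀ a, q a = s⁻¹ * f (0, a, 0) := fun a => rfl
  refine ⟨p, q, ?_, ?_, fun r α v β hv => ?_⟩
  · rw [hp, inv_mul_le_iff₀ hs0, mul_one]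
    refine le_of_forall_pos_le_add fun ε hε => ?_
    -- The point `(1, 0, 1)` is only on the boundary of `O`; it is moved inside by `ε / s`, which
    -- costs `ε` after multiplication by `s`.
    have h := (hfO (1, 0, 1 + ε / s) (by
      have : 0 < ε / s := div_pos hε hs0
      simp only [O, Set.mem_ofPred_eq, norm_zero]
      linarith)).le.trans hu
    rw [hf, show (0, 0, 0) = (0 : Matrix (Fin n) (Fin n) ℂ × Matrix (Fin n) (Fin n) ℂ × ℝ) from rfl,
      map_zero, add_mul, div_mul_cancel₀ _ hs0.ne'] at h
    linarith
  · rw [hq, inv_mul_le_iff₀ hs0, mul_one]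
    refine le_of_forall_pos_le_add fun ε hε => ?_
    have h := (hfO (0, 1, 1 + ε / s) (by
      have : 0 < ε / s := div_pos hε hs0
      simp only [O, Set.mem_ofPred_eq, norm_zero]
      linarith)).le.trans hu
    rw [hf, show (0, 0, 0) = (0 : Matrix (Fin n) (Fin n) ℂ × Matrix (Fin n) (Fin n) ℂ × ℝ) from rfl,
      map_zero, add_mul, div_mul_cancel₀ _ hs0.ne'] at h
    linarith
  · have h := hfD' _ ⟨r, α, v, β, hv, rfl⟩
    rw [hf] at h
    rw [hp, hq, ← mul_add, ← div_eq_inv_mul, le_div_iff₀ hs0]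
    linarith

end ruan


/-! ### Ruan's theorem: from states to a complete contraction -/

open Matrix in
theorem mul_mul_transpose_apply {k l m n : Type*} [Fintype m] [Fintype n] (y : Matrix k m ℂ)
    (N : Matrix m n ℂ) (x : Matrix l n ℂ) (a : k) (b : l) :
    (y * N * xᵀ) a b = ∑ i, ∑ j, y a i * N i j * x b j := by
  simp only [Matrix.mul_apply, Finset.sum_mul, Matrix.transpose_apply]
  exact Finset.sum_comm

theorem norm_sum_mul_le {m n : Type*} [Fintype m] [Fintype n] [DecidableEq m] [DecidableEq n]
    (A : Matrix m n ℂ) (y : m → ℂ) (x : n → ℂ) {c : ℝ} (hc : 0 ≤ c)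
    (hy : ∑ i, ‖y i‖ ^ 2 ≤ c) (hx : ∑ j, ‖x j‖ ^ 2 ≤ c) :
    ‖∑ i, ∑ j, y i * A i j * x j‖ ≤ opNorm A * c := by
  have h1 : ‖∑ i, ∑ j, y i * A i j * x j‖ ≤ ∑ i, ‖y i‖ * ‖∑ j, A i j * x j‖ := by
    refine (norm_sum_le _ _).trans (Finset.sum_le_sum fun i _ => ?_)
    simp only [mul_assoc]
    rw [← Finset.mul_sum, norm_mul]
  refine h1.trans (le_of_sq_le_sq ?_ (mul_nonneg (opNorm_nonneg _) hc))
  refine (Finset.sum_mul_sq_le_sq_mul_sq _ _ _).trans ?_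
  have h2 := sum_mulVec_le A x
  calc _ ≤ c * (opNorm A ^ 2 * c) := by
        refine mul_le_mul hy (h2.trans ?_) (Finset.sum_nonneg fun _ _ => sq_nonneg _) hc
        gcongr
    _ = _ := by ring

section ruanMap

variable {Z : Type*} [AddCommGroup Z] [Module ℂ Z]

/-- The map `v ↦ Aᵀ (F (e_i v e_j)) Bᵀ` defined by a functional `F` on `M_n(Z)`. -/
noncomputable def ruanMap {n : ℕ} (F : Matrix (Fin n) (Fin n) Z →ₗ[ℂ] ℂ)
    (A B : Matrix (Fin n) (Fin n) ℂ) : Z →ₗ[ℂ] Matrix (Fin n) (Fin n) ℂ where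
  toFun v := A.transpose * Matrix.of (fun i j => F (Matrix.single i j v)) * B.transpose
  map_add' u v := by
    have : Matrix.of (fun i j => F (Matrix.single i j (u + v))) =
        Matrix.of (fun i j => F (Matrix.single i j u)) +
        Matrix.of (fun i j => F (Matrix.single i j v)) := by
      ext i j; simp [Matrix.single_add]
    rw [this, Matrix.mul_add, Matrix.add_mul]
  map_smul' c v := by
    have : Matrix.of (fun i j => F (Matrix.single i j (c • v))) =
        c • Matrix.of (fun i j => F (Matrix.single i j v)) := by
      ext i j
      simp only [Matrix.of_apply, Matrix.smul_apply, ← Matrix.smul_single, map_smul]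
    rw [this, Matrix.mul_smul, Matrix.smul_mul, RingHom.id_apply]

theorem apply_bimod {n r : ℕ} (F : Matrix (Fin n) (Fin n) Z →ₗ[ℂ] ℂ)
    (α : Matrix (Fin n) (Fin r) ℂ) (v : Matrix (Fin r) (Fin r) Z) (β : Matrix (Fin r) (Fin n) ℂ) :
    F (bimod α v β) = ∑ k, ∑ l, ∑ i, ∑ j, α i k * F (Matrix.single i j (v k l)) * β l j := by
  have e : bimod α v β = ∑ k, ∑ l, ∑ i, ∑ j, (α i k * β l j) • Matrix.single i j (v k l) := by
    ext a b
    simp [bimod, Matrix.sum_apply, Matrix.single, ite_and]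
  simp only [e, map_sum, map_smul, smul_eq_mul]
  refine Finset.sum_congr rfl fun k _ => Finset.sum_congr rfl fun l _ =>
    Finset.sum_congr rfl fun i _ => Finset.sum_congr rfl fun j _ => by ring

/-- The sesquilinear forms of the amplifications of `ruanMap` are values of `F`. Hence bounds on `F
(bimod α v β)` become bounds on `amp (ruanMap F A B) v`, and conversely a good choice of vectors
recovers `F v`. -/
theorem sum_amp_ruanMap {n r : ℕ} (F : Matrix (Fin n) (Fin n) Z →ₗ[ℂ] ℂ)
    (A B : Matrix (Fin n) (Fin n) ℂ) (v : Matrix (Fin r) (Fin r) Z)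
    (y x : Matrix (Fin r) (Fin n) ℂ) :
    ∑ p : Fin r × Fin n, ∑ q : Fin r × Fin n,
      y p.1 p.2 * amp (ruanMap F A B) v p q * x q.1 q.2 =
    F (bimod (A * y.transpose) v (x * B)) := by
  rw [apply_bimod]
  simp only [Fintype.sum_prod_type]
  refine Finset.sum_congr rfl fun k _ => ?_
  rw [Finset.sum_comm]
  refine Finset.sum_congr rfl fun l _ => ?_
  have e : y * ruanMap F A B (v k l) * x.transpose = (A * y.transpose).transpose *
        Matrix.of (fun i j => F (Matrix.single i j (v k l))) * (x * B).transpose := by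
    simp [ruanMap, Matrix.transpose_mul, Matrix.mul_assoc]
  have e' := congrFun (congrFun e k) l
  rw [mul_mul_transpose_apply, mul_mul_transpose_apply] at e'
  exact e'

end ruanMap

section ruan

variable {Z : Type*} [AddCommGroup Z] [Module ℂ Z] [PreOperatorSpace Z]

theorem isCompleteContraction_of_le_one {m : ℕ} {φ : Z →ₗ[ℂ] Matrix (Fin m) (Fin m) ℂ}
    (h : ∀ (n : ℕ) (x : Matrix (Fin n) (Fin n) Z), PreOperatorSpace.mnorm n x ≤ 1 →
      opNorm (amp φ x) ≤ 1) : IsCompleteContraction φ := by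
  intro n x
  refine le_of_forall_gt_imp_ge_of_dense fun r hr => ?_
  have hr0 : 0 < r := (apply_nonneg _ _).trans_lt hr
  have h1 := h n ((r : ℂ)⁻¹ • x) (by
    rw [map_smul_eq_mul, norm_inv, Complex.norm_real, Real.norm_of_nonneg hr0.le,
      inv_mul_le_iff₀ hr0]
    linarith)
  have e : amp φ ((r : ℂ)⁻¹ • x) = (r : ℂ)⁻¹ • amp φ x := by
    ext; simp [amp]
  rw [e, opNorm_smul, norm_inv, Complex.norm_real, Real.norm_of_nonneg hr0.le,
    inv_mul_le_iff₀ hr0] at h1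
  linarith

open Matrix in
/-- Ruan's theorem: matrix norms are determined by completely contractive maps into matrix
algebras. -/
theorem mnorm_le_of_forall_isCompleteContraction {n : ℕ} (x : Matrix (Fin n) (Fin n) Z) {C : ℝ}
    (h : ∀ φ : Z →ₗ[ℂ] Matrix (Fin n) (Fin n) ℂ, IsCompleteContraction φ →
      opNorm (amp φ x) ≤ C) : PreOperatorSpace.mnorm n x ≤ C := by
  obtain ⟨F, hF, hx⟩ := exists_matrix_functional x
  obtain ⟨p, q, hp1, hq1, hpq⟩ := exists_states F hF
  have hb0 : ∀ (β : Matrix (Fin 1) (Fin n) ℂ),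
      bimod (0 : Matrix (Fin n) (Fin 1) ℂ) (0 : Matrix (Fin 1) (Fin 1) Z) β = 0 := fun β => by
    ext; simp [bimod]
  have hb0' : ∀ (α : Matrix (Fin n) (Fin 1) ℂ),
      bimod α (0 : Matrix (Fin 1) (Fin 1) Z) (0 : Matrix (Fin 1) (Fin n) ℂ) = 0 := fun β => by
    ext; simp [bimod]
  -- Positivity of `p` and `q` is contained in the domination inequality: put `v = 0` and one of the
  -- two outer factors equal to `0`.
  have hp : ∀ α : Matrix (Fin n) (Fin 1) ℂ, 0 ≤ p (α * αᴴ) := fun α => by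
    simpa [hb0'] using hpq 1 α 0 0 (by simp)
  have hq : ∀ α : Matrix (Fin n) (Fin 1) ℂ, 0 ≤ q (α * αᴴ) := fun α => by
    simpa [hb0] using hpq 1 0 0 αᴴ (by simp)
  have hC : 0 ≤ C := (opNorm_nonneg _).trans (h 0 fun k y => by
    have : amp (0 : Z →ₗ[ℂ] Matrix (Fin n) (Fin n) ℂ) y = 0 := by ext; simp [amp]
    rw [this, opNorm_zero]
    exact apply_nonneg _ _)
  have key : ∀ ε : ℝ, 0 < ε → PreOperatorSpace.mnorm n x ≤ C * (1 + ε * n) := by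
    intro ε hε
    obtain ⟨S, hS, hSp⟩ := exists_isUnit_factor p hp hε
    obtain ⟨T, hT, hTq⟩ := exists_isUnit_factor q hq hε
    -- For vectors `y`, `z` the domination inequality is used with `α = S⁻¹ Yᵀ` and `β = X (T⁻¹)ᴴ`.
    -- Then `p (α αᴴ) ≤ ‖S α‖² = ‖y‖²` and `q (βᴴ β) ≤ ‖T βᴴ‖² = ‖z‖²` in Hilbert–Schmidt norms,
    -- because the perturbations by `ε` are nonnegative.
    set φ := ruanMap F S⁻¹ (T⁻¹)ᴴ with hφ
    have hcc : IsCompleteContraction φ := by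
      refine isCompleteContraction_of_le_one fun r v hv => opNorm_le_one_of_re fun y z => ?_
      let Y : Matrix (Fin r) (Fin n) ℂ := Matrix.of fun k i => y (k, i)
      let X : Matrix (Fin r) (Fin n) ℂ := Matrix.of fun k i => z (k, i)
      have e := sum_amp_ruanMap F S⁻¹ (T⁻¹)ᴴ v Y X
      have e' := hpq r (S⁻¹ * Yᵀ) v (X * (T⁻¹)ᴴ) hv
      rw [← e] at e'
      refine e'.trans ?_
      have h1 := hSp r (S⁻¹ * Yᵀ)
      have h2 := hTq r (X * (T⁻¹)ᴴ)ᴴ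
      rw [Matrix.mul_nonsing_inv_cancel_left _ _ hS] at h1
      rw [Matrix.conjTranspose_conjTranspose, Matrix.conjTranspose_mul,
        Matrix.conjTranspose_conjTranspose, Matrix.mul_nonsing_inv_cancel_left _ _ hT] at h2
      have h3 : ∑ i, ∑ k, ‖Yᵀ i k‖ ^ 2 = ∑ i, ‖y i‖ ^ 2 := by
        rw [Fintype.sum_prod_type_right]; rfl
      have h4 : ∑ i, ∑ k, ‖Xᴴ i k‖ ^ 2 = ∑ i, ‖z i‖ ^ 2 := by
        rw [Fintype.sum_prod_type_right]
        simp [X]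
      rw [h3] at h1
      rw [h4] at h2
      have h5 : 0 ≤ ε * ∑ i, ∑ k, ‖(S⁻¹ * Yᵀ) i k‖ ^ 2 := by positivity
      have h6 : 0 ≤ ε * ∑ i, ∑ k, ‖(T⁻¹ * Xᴴ) i k‖ ^ 2 := by positivity
      have h7 : (X * (T⁻¹)ᴴ)ᴴ = T⁻¹ * Xᴴ := by simp [Matrix.conjTranspose_mul]
      rw [h7]
      linarith
    -- These vectors cancel the inverses, so the form gives back `F x = ‖x‖`. Their squared lengths
    -- are `p 1 + ε n` and `q 1 + ε n`, both at most `1 + ε n`.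
    have e := sum_amp_ruanMap F S⁻¹ (T⁻¹)ᴴ x Sᵀ Tᴴ
    have hb : bimod (1 : Matrix (Fin n) (Fin n) ℂ) x (1 : Matrix (Fin n) (Fin n) ℂ) = x := by
      simpa using bimod_smul_one 1 x
    rw [Matrix.transpose_transpose, Matrix.nonsing_inv_mul _ hS, ← Matrix.conjTranspose_mul,
      Matrix.nonsing_inv_mul _ hT, Matrix.conjTranspose_one, hb, hx] at e
    have hone : ∑ i, ∑ k, ‖(1 : Matrix (Fin n) (Fin n) ℂ) i k‖ ^ 2 = n := by
      simp [Matrix.one_apply, apply_ite]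
    have h1 := hSp n 1
    have h2 := hTq n 1
    rw [Matrix.mul_one, Matrix.conjTranspose_one, Matrix.mul_one, hone] at h1 h2
    have h3 : ∑ i : Fin n × Fin n, ‖Sᵀ i.1 i.2‖ ^ 2 = ∑ i, ∑ k, ‖S i k‖ ^ 2 := by
      rw [Fintype.sum_prod_type_right]; rfl
    have h4 : ∑ i : Fin n × Fin n, ‖Tᴴ i.1 i.2‖ ^ 2 = ∑ i, ∑ k, ‖T i k‖ ^ 2 := by
      rw [Fintype.sum_prod_type_right]; simp
    have h5 := norm_sum_mul_le (amp φ x) (fun i => Sᵀ i.1 i.2) (fun i => Tᴴ i.1 i.2)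
      (c := 1 + ε * n) (by positivity) (by rw [h3, h1]; linarith) (by rw [h4, h2]; linarith)
    rw [e, Complex.norm_real, Real.norm_of_nonneg (apply_nonneg _ _)] at h5
    exact h5.trans (mul_le_mul_of_nonneg_right (h φ hcc) (by positivity))
  have ht : Filter.Tendsto (fun ε : ℝ => C * (1 + ε * n)) (nhdsWithin 0 (Set.Ioi 0))
      (nhds (C * (1 + 0 * n))) :=
    (Continuous.tendsto (by fun_prop) _).mono_left nhdsWithin_le_nhds
  rw [zero_mul, add_zero, mul_one] at ht
  exact ge_of_tendsto ht (eventually_nhdsWithin_of_forall fun ε hε => key ε hε)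

end ruan


/-! ### Kronecker products and the projective tensor norm -/

/-- The operator norm of the Kronecker product of two complex matrices. -/
theorem opNorm_kronecker_le {k l m n : Type*} [Fintype k] [Fintype l] [Fintype m] [Fintype n]
    [DecidableEq k] [DecidableEq l] [DecidableEq m] [DecidableEq n]
    (A : Matrix k l ℂ) (B : Matrix m n ℂ) :
    opNorm (Matrix.of fun (i : k × m) (j : l × n) => A i.1 j.1 * B i.2 j.2) ≤
      opNorm A * opNorm B := by
  -- `A ⊗ B = (A ⊗ 1)(1 ⊗ B)`, where `1 ⊗ B` is `B ⊗ 1` with the two indices exchanged.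
  have e : (Matrix.of fun (i : k × m) (j : l × n) => A i.1 j.1 * B i.2 j.2) =
      (Matrix.of fun (i : k × m) (j : l × m) => if i.2 = j.2 then A i.1 j.1 else 0) *
      (Matrix.of fun (i : m × l) (j : n × l) => if i.2 = j.2 then B i.1 j.1 else 0).submatrix
        Prod.swap Prod.swap := by
    ext i j
    simp [Matrix.mul_apply, Fintype.sum_prod_type]
  rw [e]
  refine (opNorm_mul _ _).trans (mul_le_mul (opNorm_kron_one_le A)
    ((opNorm_submatrix_le _ Prod.swap_injective Prod.swap_injective).trans (opNorm_kron_one_le B))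
    (opNorm_nonneg _) (opNorm_nonneg _))

/-- The matrix `(φ (x i j))` of a matrix `x` with an arbitrary index set. -/
def ampOn {V : Type*} [AddCommGroup V] [Module ℂ V] {m : ℕ} {k : Type*}
    (φ : V →ₗ[ℂ] Matrix (Fin m) (Fin m) ℂ) (x : Matrix k k V) :
    Matrix (k × Fin m) (k × Fin m) ℂ :=
  Matrix.of fun p q => φ (x p.1 q.1) p.2 q.2

theorem opNorm_ampOn_bimod_le {V : Type*} [AddCommGroup V] [Module ℂ V] {m : ℕ}
    (φ : V →ₗ[ℂ] Matrix (Fin m) (Fin m) ℂ) {n k : Type*} [Fintype n] [Fintype k]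
    [DecidableEq n] [DecidableEq k] (α : Matrix n k ℂ) (x : Matrix k k V) (β : Matrix k n ℂ) :
    opNorm (ampOn φ (bimod α x β)) ≤ opNorm α * opNorm (ampOn φ x) * opNorm β := by
  have e : ampOn φ (bimod α x β) =
      (Matrix.of fun (i : n × Fin m) (j : k × Fin m) => if i.2 = j.2 then α i.1 j.1 else 0) *
        ampOn φ x *
      (Matrix.of fun (i : k × Fin m) (j : n × Fin m) => if i.2 = j.2 then β i.1 j.1 else 0) := by
    ext p q
    rw [Matrix.mul_assoc]
    simp [ampOn, bimod, Matrix.mul_apply, Fintype.sum_prod_type, Matrix.sum_apply,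
      Finset.mul_sum]
    exact Finset.sum_congr rfl fun _ _ => Finset.sum_congr rfl fun _ _ => by ring
  rw [e]
  refine (opNorm_mul _ _).trans ?_
  refine mul_le_mul ((opNorm_mul _ _).trans (mul_le_mul_of_nonneg_right
    (opNorm_kron_one_le α) (opNorm_nonneg _))) (opNorm_kron_one_le β) (opNorm_nonneg _)
    (mul_nonneg (opNorm_nonneg _) (opNorm_nonneg _))

theorem opNorm_one_submatrix_le {k l m : Type*} [Fintype k] [Fintype l] [Fintype m]
    [DecidableEq k] [DecidableEq l] [DecidableEq m]
    {f : k → m} {g : l → m} (hf : f.Injective) (hg : g.Injective) :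
    opNorm ((1 : Matrix m m ℂ).submatrix f g) ≤ 1 :=
  (opNorm_submatrix_le _ hf hg).trans opNorm_one_le

theorem bimod_one_submatrix {V : Type*} [AddCommGroup V] [Module ℂ V] {k m : Type*}
    [Fintype m] [DecidableEq m] (f : k → m) (x : Matrix m m V) :
    bimod ((1 : Matrix m m ℂ).submatrix f id) x ((1 : Matrix m m ℂ).submatrix id f) =
      x.submatrix f f := by
  ext i j
  simp [bimod, Matrix.one_apply]

section tensor

open scoped TensorProduct

variable {V W : Type*} [AddCommGroup V] [Module ℂ V] [AddCommGroup W] [Module ℂ W]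
  [PreOperatorSpace V] [PreOperatorSpace W]

/-- The selection matrices of `f` are contractions, so they give an admissible factorization. An
injection `f` allows `kron`, which is indexed by pairs, to be used with the norms, which are defined
for `Fin n`. -/
theorem mnorm_submatrix_kron_le {p q : ℕ} (v : Matrix (Fin p) (Fin p) V)
    (w : Matrix (Fin q) (Fin q) W) {n : ℕ} {f : Fin n → Fin p × Fin q} (hf : f.Injective) :
    PreOperatorSpace.mnorm n ((kron v w).submatrix f f) ≤
      PreOperatorSpace.mnorm p v * PreOperatorSpace.mnorm q w := by
  refine (csInf_le (bddBelow_projSet _) ⟨p, q, v, w, _, _, (bimod_one_submatrix f _).symm,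
    rfl⟩).trans ?_
  have h1 := opNorm_one_submatrix_le (m := Fin p × Fin q) hf Function.injective_id
  have h2 := opNorm_one_submatrix_le (m := Fin p × Fin q) Function.injective_id hf
  have h3 := opNorm_nonneg ((1 : Matrix (Fin p × Fin q) (Fin p × Fin q) ℂ).submatrix id f)
  calc _ ≤ 1 * PreOperatorSpace.mnorm p v * PreOperatorSpace.mnorm q w * 1 := by gcongr
    _ = _ := by ring

theorem vnorm_tmul_le (v : V) (w : W) : vnorm (v ⊗ₜ[ℂ] w) ≤ vnorm v * vnorm w :=
  mnorm_submatrix_kron_le (Matrix.of fun _ _ : Fin 1 => v) (Matrix.of fun _ _ : Fin 1 => w)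
    (f := fun _ : Fin 1 => (0, 0)) (fun _ _ _ => Subsingleton.elim _ _)

/-- Converse of `isCompleteContraction_of_kron`: the projective norm is subcross, so complete
contractivity gives joint complete contractivity. -/
theorem IsCompleteContraction.opNorm_kron_le {m : ℕ}
    {Φ : V ⊗[ℂ] W →ₗ[ℂ] Matrix (Fin m) (Fin m) ℂ} (h : IsCompleteContraction Φ) {p q : ℕ}
    (v : Matrix (Fin p) (Fin p) V) (w : Matrix (Fin q) (Fin q) W) :
    opNorm (ampOn Φ (kron v w)) ≤ PreOperatorSpace.mnorm p v * PreOperatorSpace.mnorm q w := by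
  let e : Fin p × Fin q ≃ Fin (p * q) := finProdFinEquiv
  refine le_trans ?_ ((h _ _).trans (mnorm_submatrix_kron_le v w e.symm.injective))
  have : ampOn Φ (kron v w) = (amp Φ ((kron v w).submatrix e.symm e.symm)).submatrix
      (Prod.map e id) (Prod.map e id) := by
    ext i j
    simp [amp, ampOn]
  rw [this]
  exact opNorm_submatrix_le _ (e.injective.prodMap Function.injective_id)
    (e.injective.prodMap Function.injective_id)

/-- A linear map on `V ⊗ W` is completely contractive if it is jointly completely contractive as a
bilinear map. -/
theorem isCompleteContraction_of_kron {m : ℕ}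
    {Φ : V ⊗[ℂ] W →ₗ[ℂ] Matrix (Fin m) (Fin m) ℂ}
    (h : ∀ (p q : ℕ) (v : Matrix (Fin p) (Fin p) V) (w : Matrix (Fin q) (Fin q) W),
      PreOperatorSpace.mnorm p v ≤ 1 → PreOperatorSpace.mnorm q w ≤ 1 →
      opNorm (ampOn Φ (kron v w)) ≤ 1) : IsCompleteContraction Φ := by
  intro n U
  refine le_of_forall_gt_imp_ge_of_dense fun r hr => ?_
  obtain ⟨p, q, v, w, α, β, rfl, hv, hw, hα, hβ⟩ := hasFact_of_lt hr
  refine (opNorm_ampOn_bimod_le Φ α (kron v w) β).trans ?_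
  have h1 := h p q v w hv hw
  have h2 := opNorm_nonneg β
  have h3 := opNorm_nonneg (ampOn Φ (kron v w))
  calc _ ≤ 1 * 1 * opNorm β := by gcongr
    _ ≤ r := by linarith

variable {V' : Type*} [AddCommGroup V'] [Module ℂ V'] [PreOperatorSpace V']

/-- Apply `f` to the first factor of every factorization `α (v ⊗ w) β`. The constant `c` will be `1`
or the weight of a summand of an `ℓ¹`-sum. -/
theorem mnorm_map_rTensor_le {c : ℝ} (hc : 0 < c) {f : V →ₗ[ℂ] V'}
    (hf : ∀ (n : ℕ) (x : Matrix (Fin n) (Fin n) V),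
      PreOperatorSpace.mnorm n (x.map f) ≤ c * PreOperatorSpace.mnorm n x)
    {n : ℕ} (U : Matrix (Fin n) (Fin n) (V ⊗[ℂ] W)) :
    PreOperatorSpace.mnorm n (U.map (f.rTensor W)) ≤ c * PreOperatorSpace.mnorm n U := by
  rw [← inv_mul_le_iff₀ hc]
  refine le_csInf (projSet_nonempty U) ?_
  rintro _ ⟨p, q, v, w, α, β, rfl, rfl⟩
  rw [inv_mul_le_iff₀ hc, bimod_map]
  have e : (kron v w).map (f.rTensor W) = kron (v.map f) w := by
    ext i j
    simp [kron]
  rw [e]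
  refine (csInf_le (bddBelow_projSet _) ⟨p, q, v.map f, w, α, β, rfl, rfl⟩).trans ?_
  have h1 := opNorm_nonneg α
  have h2 := opNorm_nonneg β
  calc _ ≤ opNorm α * (c * PreOperatorSpace.mnorm p v) * PreOperatorSpace.mnorm q w * opNorm β := by
        gcongr
        exact hf p v
    _ = _ := by ring

/-- Ruan's theorem in the target: complete contractivity of `f` needs checking only after
composition with complete contractions into matrix algebras. -/
theorem mnorm_map_le_of_isCompleteContraction {f : V →ₗ[ℂ] W}
    (h : ∀ (m : ℕ) (φ : W →ₗ[ℂ] Matrix (Fin m) (Fin m) ℂ), IsCompleteContraction φ →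
      IsCompleteContraction (φ ∘ₗ f)) {n : ℕ} (x : Matrix (Fin n) (Fin n) V) :
    PreOperatorSpace.mnorm n (x.map f) ≤ PreOperatorSpace.mnorm n x :=
  mnorm_le_of_forall_isCompleteContraction _ fun φ hφ => h n φ hφ n x

/-- For `≤`, a complete contraction `φ` on `V` sends `v ⊗ c` to the Kronecker product of its
amplification at `v` with the scalar matrix `c`, up to a permutation of indices. For `≥`, each `U`
has the factorization `x ⊗ 1`. -/
theorem mnorm_map_rid {n : ℕ} (U : Matrix (Fin n) (Fin n) (V ⊗[ℂ] ℂ)) :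
    PreOperatorSpace.mnorm n (U.map (TensorProduct.rid ℂ V)) = PreOperatorSpace.mnorm n U := by
  refine le_antisymm (mnorm_map_le_of_isCompleteContraction
    (f := (TensorProduct.rid ℂ V).toLinearMap) (fun m φ hφ => ?_) U) ?_
  · refine isCompleteContraction_of_kron fun p q v c hv hc => ?_
    let f : (Fin p × Fin q) × Fin m → (Fin p × Fin m) × Fin q := fun i => ((i.1.1, i.2), i.1.2)
    have hf : f.Injective := by
      rintro ⟨⟨a, b⟩, c⟩ ⟨⟨a', b'⟩, c'⟩ h
      simp only [f, Prod.mk.injEq] at h ⊢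
      tauto
    have e : ampOn (φ ∘ₗ (TensorProduct.rid ℂ V).toLinearMap) (kron v c) =
        (Matrix.of fun (i j : (Fin p × Fin m) × Fin q) =>
          amp φ v i.1 j.1 * c i.2 j.2).submatrix f f := by
      ext i j
      simp [ampOn, amp, kron, f, mul_comm]
    rw [e]
    refine (opNorm_submatrix_le _ hf hf).trans ((opNorm_kronecker_le _ _).trans ?_)
    exact mul_le_one₀ ((hφ p v).trans hv) (opNorm_nonneg _) hc
  · set x := U.map (TensorProduct.rid ℂ V) with hx
    have e : U = (kron x (1 : Matrix (Fin 1) (Fin 1) ℂ)).submatrix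
        (fun i => (i, 0)) (fun i => (i, 0)) := by
      ext i j
      simp [kron, hx, ← TensorProduct.rid_symm_apply]
    rw [e]
    refine (mnorm_submatrix_kron_le x 1 (fun i j h => (Prod.mk.inj h).1)).trans ?_
    have h1 : PreOperatorSpace.mnorm 1 (1 : Matrix (Fin 1) (Fin 1) ℂ) ≤ 1 := opNorm_one_le
    exact mul_le_of_le_one_right (apply_nonneg _ _) h1

theorem mnorm_map_lid_le {n : ℕ} (U : Matrix (Fin n) (Fin n) (ℂ ⊗[ℂ] W)) :
    PreOperatorSpace.mnorm n (U.map (TensorProduct.lid ℂ W)) ≤ PreOperatorSpace.mnorm n U := by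
  refine mnorm_map_le_of_isCompleteContraction
    (f := (TensorProduct.lid ℂ W).toLinearMap) (fun m φ hφ => ?_) U
  refine isCompleteContraction_of_kron fun p q c w hc hw => ?_
  let f : (Fin p × Fin q) × Fin m → Fin p × (Fin q × Fin m) := fun i => (i.1.1, i.1.2, i.2)
  have hf : f.Injective := (Equiv.prodAssoc _ _ _).injective
  have e : ampOn (φ ∘ₗ (TensorProduct.lid ℂ W).toLinearMap) (kron c w) =
      (Matrix.of fun (i j : Fin p × (Fin q × Fin m)) =>
        c i.1 j.1 * amp φ w i.2 j.2).submatrix f f := by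
    ext i j
    simp [ampOn, amp, kron, f]
  rw [e]
  refine (opNorm_submatrix_le _ hf hf).trans ((opNorm_kronecker_le _ _).trans ?_)
  exact mul_le_one₀ hc (opNorm_nonneg _) ((hφ q w).trans hw)

end tensor


/-! ### The spaces `S_d^1(E)`: tensor identification and comparison with entries -/

section ofMaps

variable {V : Type*} [AddCommGroup V] [Module ℂ V]

theorem opNorm_amp_le_ofMaps {ι : Type*} (m : ι → ℕ)
    (φ : ∀ i, V →ₗ[ℂ] Matrix (Fin (m i)) (Fin (m i)) ℂ)
    (hφ : ∀ v, ∃ C : ℝ, ∀ i, opNorm (φ i v) ≤ C) {n : ℕ} (x : Matrix (Fin n) (Fin n) V) (i : ι) :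
    opNorm (amp (φ i) x) ≤ (PreOperatorSpace.ofMaps m φ hφ).mnorm n x := by
  have hφ' := hφ
  choose C hC using hφ'
  refine le_ciSup (f := fun i => opNorm (amp (φ i) x)) ⟨∑ i, ∑ j, C (x i j), ?_⟩ i
  rintro _ ⟨i, rfl⟩
  exact (opNorm_amp_le _ _).trans
    (Finset.sum_le_sum fun _ _ => Finset.sum_le_sum fun _ _ => hC _ _)

end ofMaps

section schatten

open scoped TensorProduct

variable (d : ℕ) (E : Type*) [AddCommGroup E] [Module ℂ E]

/-- The identity map from `S_d^1(ℂ)` to `S_d^1`. -/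
noncomputable def schattenScalar : Schatten1V d ℂ ≃ₗ[ℂ] Schatten1 d :=
  LinearEquiv.refl ℂ (Matrix (Fin d) (Fin d) ℂ)

/-- The map `A ⊗ e ↦ (A i j • e)`. -/
noncomputable def tensorToSchatten : Schatten1V d ℂ ⊗[ℂ] E →ₗ[ℂ] Schatten1V d E :=
  TensorProduct.lift (LinearMap.mk₂ ℂ
    (fun (A : Matrix (Fin d) (Fin d) ℂ) (e : E) =>
      (Matrix.of fun i j => A i j • e : Matrix (Fin d) (Fin d) E))
    (fun A B e => Matrix.ext fun i j => add_smul (A i j) (B i j) e)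
    (fun c A e => Matrix.ext fun i j => mul_smul c (A i j) e)
    (fun A e f => Matrix.ext fun i j => smul_add (A i j) e f)
    (fun c A e => Matrix.ext fun i j => smul_comm (A i j) c e))

/-- The map `matrixToTensor`, as a map on `S_d^1(E)`. -/
noncomputable def schattenToTensor : Schatten1V d E →ₗ[ℂ] Schatten1 d ⊗[ℂ] E :=
  matrixToTensor d E

variable {d E}

theorem tensorToSchatten_tmul (A : Schatten1V d ℂ) (e : E) (i j : Fin d) :
    tensorToSchatten d E (A ⊗ₜ e) i j = A i j • e := rfl

theorem schattenToTensor_apply (x : Schatten1V d E) :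
    schattenToTensor d E x = ∑ i, ∑ j, Schatten1.unit i j ⊗ₜ x i j := rfl

theorem sum_smul_unit (A : Schatten1 d) : ∑ i, ∑ j, A i j • Schatten1.unit i j = A := by
  have h := Matrix.matrix_eq_sum_single (A : Matrix (Fin d) (Fin d) ℂ)
  refine Eq.trans ?_ h.symm
  refine Finset.sum_congr rfl fun i _ => Finset.sum_congr rfl fun j _ => ?_
  exact (Matrix.smul_single _ _ _ _).trans (by simp)

/-- `∑ e_ij ⊗ A_ij e = (∑ A_ij e_ij) ⊗ e`: the scalars move across the tensor sign. -/
theorem schattenToTensor_tensorToSchatten (u : Schatten1V d ℂ ⊗[ℂ] E) :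
    schattenToTensor d E (tensorToSchatten d E u) =
      (schattenScalar d).toLinearMap.rTensor E u := by
  induction u using TensorProduct.induction_on with
  | zero => simp
  | add x y hx hy => rw [map_add, map_add, map_add, hx, hy]
  | tmul A e =>
    change ∑ i, ∑ j, Schatten1.unit i j ⊗ₜ (A i j • e) = (schattenScalar d A) ⊗ₜ e
    simp only [← TensorProduct.smul_tmul, ← TensorProduct.sum_tmul]
    congr 1
    exact sum_smul_unit _

/-- The identification of `S_d^1(ℂ) ⊗ E` with `S_d^1(E)`. -/
noncomputable def tensorEquivSchatten (d : ℕ) (E : Type*) [AddCommGroup E] [Module ℂ E] :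
    Schatten1V d ℂ ⊗[ℂ] E ≃ₗ[ℂ] Schatten1V d E :=
  LinearEquiv.ofLinearMap (tensorToSchatten d E)
    ((schattenScalar d).symm.toLinearMap.rTensor E ∘ₗ schattenToTensor d E)
    (by
      ext x
      refine Matrix.ext fun k l => ?_
      have : (schattenScalar d).symm.toLinearMap.rTensor E (schattenToTensor d E x) =
          ∑ i, ∑ j, (schattenScalar d).symm (Schatten1.unit i j) ⊗ₜ x i j := by
        simp [schattenToTensor_apply]
      rw [LinearMap.comp_apply, LinearMap.comp_apply, this, map_sum]
      simp only [map_sum]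
      have e : ∀ F : Fin d → Fin d → Schatten1V d E, (∑ i, ∑ j, F i j) k l =
          ∑ i, ∑ j, F i j k l := fun F => by
        refine (Matrix.sum_apply k l Finset.univ fun i => ∑ j, F i j).trans
          (Finset.sum_congr rfl fun i _ => Matrix.sum_apply k l Finset.univ fun j => F i j)
      rw [e]
      simp only [tensorToSchatten_tmul]
      change ∑ i, ∑ j, (Matrix.single i j (1 : ℂ)) k l • x i j = x k l
      simp [Matrix.single, ite_and])
    (by
      refine LinearMap.ext fun u => ?_
      rw [LinearMap.comp_apply, LinearMap.comp_apply, schattenToTensor_tensorToSchatten,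
        ← LinearMap.comp_apply, ← LinearMap.rTensor_comp]
      simp)

variable [PreOperatorSpace E]

/-- The norm of `S_d^1(ℂ)` is by definition that of `S_d^1 ⊗ ℂ`, so this is an instance of `V ⊗ ℂ =
V`. -/
theorem mnorm_map_schattenScalar {n : ℕ} (v : Matrix (Fin n) (Fin n) (Schatten1V d ℂ)) :
    PreOperatorSpace.mnorm n (v.map (schattenScalar d)) = PreOperatorSpace.mnorm n v := by
  have h : PreOperatorSpace.mnorm n v =
    PreOperatorSpace.mnorm n (v.map (schattenToTensor d ℂ)) := rfl
  rw [h, ← mnorm_map_rid]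
  congr 1
  ext i j
  simp only [Matrix.map_apply, schattenToTensor_apply, map_sum, TensorProduct.rid_tmul]
  exact (sum_smul_unit _).symm

/-- Since the norm of `S_d^1(E)` is pulled back from `S_d^1 ⊗ E`, the map amounts to `schattenScalar
⊗ id`. It and its inverse are contractive at every matrix level by functoriality of the projective
norm. -/
theorem isCompleteIsometry_tensorEquivSchatten :
    IsCompleteIsometry (tensorEquivSchatten d E).toLinearMap := by
  intro n U
  have h : PreOperatorSpace.mnorm n (U.map (tensorEquivSchatten d E).toLinearMap) =
      PreOperatorSpace.mnorm n (U.map ((schattenScalar d).toLinearMap.rTensor E)) := by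
    change PreOperatorSpace.mnorm n
      ((U.map (tensorToSchatten d E)).map (schattenToTensor d E)) = _
    congr 1
    ext i j
    exact schattenToTensor_tensorToSchatten _
  rw [h]
  refine le_antisymm ((mnorm_map_rTensor_le one_pos (fun n x => ?_) U).trans_eq (one_mul _)) ?_
  · rw [one_mul]
    exact (mnorm_map_schattenScalar x).le
  · set U' := U.map ((schattenScalar d).toLinearMap.rTensor E) with hU'
    have e : U = U'.map ((schattenScalar d).symm.toLinearMap.rTensor E) := by
      refine Matrix.ext fun i j => ?_
      rw [hU', Matrix.map_apply, Matrix.map_apply, ← LinearMap.comp_apply,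
        ← LinearMap.rTensor_comp]
      simp
    conv_lhs => rw [e]
    refine (mnorm_map_rTensor_le one_pos (fun n x => ?_) U').trans_eq (one_mul _)
    rw [one_mul, ← mnorm_map_schattenScalar]
    refine le_of_eq (congrArg _ ?_)
    refine Matrix.ext fun i j => ?_
    simp

theorem vnorm_schatten_eq (x : Schatten1V d E) : vnorm x = vnorm (schattenToTensor d E x) := rfl

/-- The entry `(a, b)` is the trace pairing with the matrix unit `e_ba`, a point of the unit ball of
`M_1(M_d)`, hence one of the maps in the supremum defining the norm. -/
theorem norm_entry_le_mnorm {n : ℕ} (a b : Fin d) (v : Matrix (Fin n) (Fin n) (Schatten1 d)) :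
    opNorm (Matrix.of fun r s => v r s a b) ≤ PreOperatorSpace.mnorm n v := by
  let A : Matrix (Fin 1 × Fin d) (Fin 1 × Fin d) ℂ := Matrix.single (0, b) (0, a) 1
  have hA : opNorm A ≤ 1 := by
    refine (opNorm_pad_le (1 : Matrix (Fin 1) (Fin 1) ℂ) A (f := fun _ => (0, b))
      (g := fun _ => (0, a)) (fun _ _ _ => Subsingleton.elim _ _)
      (fun _ _ _ => Subsingleton.elim _ _) (fun i j => ?_) (fun i hi j => ?_)
      (fun j hj i => ?_)).trans opNorm_one_le
    · rw [Subsingleton.elim i j]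
      simp [A]
    · exact Matrix.single_apply_of_row_ne (fun h => hi ⟨0, h⟩) _ _ _
    · exact Matrix.single_apply_of_col_ne _ _ (fun h => hj ⟨0, h⟩) _
  have h := opNorm_amp_le_ofMaps
    (ι := Σ p : ℕ, {A : Matrix (Fin p × Fin d) (Fin p × Fin d) ℂ // opNorm A ≤ 1})
    (fun i => i.1) (fun i => tracePairing i.2.1)
    (fun _ => ⟨_, fun i => opNorm_tracePairing_le i.2.2 _⟩) v ⟨1, A, hA⟩
  refine le_trans ?_ h
  have e : (Matrix.of fun r s => v r s a b) = (amp (tracePairing A) v).submatrix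
      (fun r => (r, 0)) (fun r => (r, 0)) := by
    ext r s
    have hs : A.submatrix (Prod.mk 0) (Prod.mk 0) = Matrix.single b a 1 := by
      ext i j
      simp [A, Matrix.single]
    have hB : ∀ B : Matrix (Fin d) (Fin d) ℂ,
        B a b = Matrix.trace (A.submatrix (Prod.mk 0) (Prod.mk 0) * B) := fun B => by
      rw [hs, Matrix.trace_single_mul, one_smul]
    exact hB (v r s)
  rw [e]
  exact opNorm_submatrix_le _ (fun _ _ h => (Prod.mk.inj h).1) (fun _ _ h => (Prod.mk.inj h).1)

/-- Tensor the entry functional on `S_d^1` with the identity of `E`, then apply the contraction `ℂ ⊗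
E → E`. With `vnorm_schatten_le` this makes convergence in `S_d^1(E)` the same as entrywise
convergence. -/
theorem vnorm_apply_le (x : Schatten1V d E) (a b : Fin d) : vnorm (x a b) ≤ vnorm x := by
  let f : Schatten1 d →ₗ[ℂ] ℂ := Matrix.entryLinearMap ℂ ℂ a b
  have h1 := mnorm_map_rTensor_le (W := E) (f := f) one_pos
    (fun n v => (norm_entry_le_mnorm a b v).trans_eq (one_mul _).symm)
    (Matrix.of fun _ _ : Fin 1 => schattenToTensor d E x)
  have h2 := mnorm_map_lid_le ((Matrix.of fun _ _ : Fin 1 => schattenToTensor d E x).map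
    (f.rTensor E))
  rw [one_mul] at h1
  refine le_trans (le_of_eq ?_) (h2.trans h1)
  refine congrArg _ (Matrix.ext fun _ _ => ?_)
  simp only [Matrix.of_apply, Matrix.map_apply, schattenToTensor_apply, map_sum, LinearMap.rTensor_tmul, TensorProduct.lid_tmul]
  change x a b = ∑ i, ∑ j, (Matrix.single i j (1 : ℂ)) a b • x i j
  simp [Matrix.single, ite_and]

theorem vnorm_schatten_le (x : Schatten1V d E) :
    vnorm x ≤ ∑ i, ∑ j, vnorm (Schatten1.unit i j : Schatten1 d) * vnorm (x i j) := by
  have sub : ∀ {V : Type _} [AddCommGroup V] [Module ℂ V] [PreOperatorSpace V] (F : Fin d → V),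
      vnorm (∑ i, F i) ≤ ∑ i, vnorm (F i) := fun F =>
    Finset.le_sum_of_subadditive _ vnorm_zero.le vnorm_add_le _ _
  rw [vnorm_schatten_eq]
  exact (sub _).trans (Finset.sum_le_sum fun i _ => (sub _).trans
    (Finset.sum_le_sum fun j _ => vnorm_tmul_le _ _))

end schatten


/-! ### Tensor products of weighted `ℓ¹`-sums -/

/-- The algebraic tensor product of complex vector spaces. -/
abbrev AlgTensor (V W : Type*) [AddCommGroup V] [Module ℂ V] [AddCommGroup W] [Module ℂ W] :
    Type _ := TensorProduct ℂ V W

section ell1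

open scoped TensorProduct

variable {I : Type*} {w : I → NNReal} {X Y : I → Type*} [∀ i, AddCommGroup (X i)]
  [∀ i, Module ℂ (X i)] [∀ i, PreOperatorSpace (X i)] [∀ i, AddCommGroup (Y i)]
  [∀ i, Module ℂ (Y i)] [∀ i, PreOperatorSpace (Y i)]
  {E : Type*} [AddCommGroup E] [Module ℂ E] [PreOperatorSpace E]

theorem IsCompleteIsometry.vnorm_eq {V W : Type*} [AddCommGroup V] [Module ℂ V]
    [PreOperatorSpace V] [AddCommGroup W] [Module ℂ W] [PreOperatorSpace W] {u : V →ₗ[ℂ] W}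
    (h : IsCompleteIsometry u) (x : V) : vnorm (u x) = vnorm x :=
  h 1 (Matrix.of fun _ _ => x)

theorem IsCompleteContraction.comp_isometry {V W : Type*} [AddCommGroup V] [Module ℂ V]
    [PreOperatorSpace V] [AddCommGroup W] [Module ℂ W] [PreOperatorSpace W] {m : ℕ}
    {φ : W →ₗ[ℂ] Matrix (Fin m) (Fin m) ℂ} (hφ : IsCompleteContraction φ) {u : V →ₗ[ℂ] W}
    (h : IsCompleteIsometry u) : IsCompleteContraction (φ ∘ₗ u) := fun n x =>
  (hφ n (x.map u)).trans_eq (h n x)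

theorem opNorm_amp_sumMap_le {m : ℕ} (φ : ∀ i, X i →ₗ[ℂ] Matrix (Fin m) (Fin m) ℂ)
    (hφ : ∀ i, IsCompleteContraction (φ i)) {n : ℕ} (x : Matrix (Fin n) (Fin n) (ell1 w X)) :
    opNorm (amp (sumMap φ hφ) x) ≤ PreOperatorSpace.mnorm n x :=
  opNorm_amp_le_ofMaps
    (ι := Σ m : ℕ, {φ : ∀ i, X i →ₗ[ℂ] Matrix (Fin m) (Fin m) ℂ //
      ∀ i, IsCompleteContraction (φ i)})
    (fun j => j.1) (fun j => sumMap j.2.1 j.2.2)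
    (fun x => ⟨_, fun j => opNorm_sumMap_le j.2.1 j.2.2 x⟩) x ⟨m, φ, hφ⟩

theorem mnorm_ell1_le {n : ℕ} {x : Matrix (Fin n) (Fin n) (ell1 w X)} {C : ℝ} (hC : 0 ≤ C)
    (h : ∀ (m : ℕ) (φ : ∀ i, X i →ₗ[ℂ] Matrix (Fin m) (Fin m) ℂ)
      (hφ : ∀ i, IsCompleteContraction (φ i)), opNorm (amp (sumMap φ hφ) x) ≤ C) :
    PreOperatorSpace.mnorm n x ≤ C :=
  Real.iSup_le (fun j => h j.1 j.2.1 j.2.2) hC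

theorem sumMap_apply {m : ℕ} (φ : ∀ i, X i →ₗ[ℂ] Matrix (Fin m) (Fin m) ℂ)
    (hφ : ∀ i, IsCompleteContraction (φ i)) (x : ell1 w X) (a b : Fin m) :
    sumMap φ hφ x a b = ∑' i, ((w i : ℝ) : ℂ) * φ i (x.1 i) a b := rfl

open Classical in
/-- The inclusion of a summand of an `ℓ¹`-sum. -/
noncomputable def ell1Single (w : I → NNReal) (X : I → Type*) [∀ i, AddCommGroup (X i)]
    [∀ i, Module ℂ (X i)] [∀ i, PreOperatorSpace (X i)] (i : I) : X i →ₗ[ℂ] ell1 w X :=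
  (LinearMap.single ℂ X i).codRestrict (ell1 w X) fun x => by
    refine summable_of_ne_finset_zero (s := {i}) fun j hj => ?_
    rw [LinearMap.single_apply, Pi.single_eq_of_ne (by simpa using hj), vnorm_zero, mul_zero]

theorem ell1Single_same (i : I) (x : X i) : (ell1Single w X i x).1 i = x := by
  classical exact Pi.single_eq_same (M := X) i x

theorem ell1Single_of_ne {i j : I} (h : j ≠ i) (x : X i) : (ell1Single w X i x).1 j = 0 := by
  classical exact Pi.single_eq_of_ne (M := X) h x

theorem sumMap_ell1Single {m : ℕ} (φ : ∀ i, X i →ₗ[ℂ] Matrix (Fin m) (Fin m) ℂ)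
    (hφ : ∀ i, IsCompleteContraction (φ i)) (i : I) (x : X i) :
    sumMap φ hφ (ell1Single w X i x) = ((w i : ℝ) : ℂ) • φ i x := by
  ext a b
  rw [sumMap_apply, tsum_eq_single i fun j hj => by simp [ell1Single_of_ne hj], ell1Single_same,
    Matrix.smul_apply, smul_eq_mul]

/-- On the `i`-th summand every test `sumMap φ` reduces to `w i • φ i`. -/
theorem mnorm_map_ell1Single_le (i : I) {n : ℕ} (v : Matrix (Fin n) (Fin n) (X i)) :
    PreOperatorSpace.mnorm n (v.map (ell1Single w X i)) ≤ w i * PreOperatorSpace.mnorm n v := by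
  refine mnorm_ell1_le (mul_nonneg (w i).coe_nonneg (apply_nonneg _ _)) fun m φ hφ => ?_
  have e : amp (sumMap φ hφ) (v.map (ell1Single w X i)) = ((w i : ℝ) : ℂ) • amp (φ i) v := by
    ext p q
    simp [amp, sumMap_ell1Single]
  rw [e, opNorm_smul, Complex.norm_real, Real.norm_of_nonneg (w i).coe_nonneg]
  exact mul_le_mul_of_nonneg_left (hφ i n v) (w i).coe_nonneg

/-- A bounded functional on an `ℓ¹`-sum is determined by the summands. -/
theorem hasSum_ell1Single (L : ell1 w X →ₗ[ℂ] ℂ) {C : ℝ} (hL : ∀ x, ‖L x‖ ≤ C * vnorm x)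
    (x : ell1 w X) : HasSum (fun i => L (ell1Single w X i (x.1 i))) (L x) := by
  classical
  -- The error of a finite truncation is the tail of the series for `‖x‖`, which tends to zero along
  -- finite sets; boundedness of `L` then gives the sum.
  have h1 : ∀ s : Finset I, vnorm (x - ∑ i ∈ s, ell1Single w X i (x.1 i)) =
      ∑' i : {i // i ∉ s}, (w i : ℝ) * vnorm (x.1 i) := by
    intro s
    rw [vnorm_ell1]
    refine Eq.trans ?_ (tsum_subtype {i | i ∉ s} fun i => (w i : ℝ) * vnorm (x.1 i)).symm
    refine tsum_congr fun i => ?_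
    have e : (x - ∑ j ∈ s, ell1Single w X j (x.1 j)).1 i = if i ∈ s then 0 else x.1 i := by
      rw [Submodule.coe_sub, Submodule.coe_sum, Pi.sub_apply, Finset.sum_apply]
      split_ifs with h
      · rw [Finset.sum_eq_single i (fun j _ hj => ell1Single_of_ne hj.symm _)
          (fun h' => absurd h h'), ell1Single_same, sub_self]
      · rw [Finset.sum_eq_zero fun j hj => ell1Single_of_ne (by rintro rfl; exact h hj) _, sub_zero]
    rw [e]
    by_cases h : i ∈ s <;> simp [h, vnorm_zero]
  have h2 := tendsto_tsum_compl_atTop_zero fun i => (w i : ℝ) * vnorm (x.1 i)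
  rw [HasSum, tendsto_iff_norm_sub_tendsto_zero]
  refine squeeze_zero (fun _ => norm_nonneg _) (fun s => ?_)
    (by simpa using h2.const_mul C)
  rw [← map_sum, norm_sub_rev, ← map_sub]
  exact (hL _).trans_eq (by rw [h1])

variable (e : ∀ i, X i ⊗[ℂ] E ≃ₗ[ℂ] Y i) (he : ∀ i, IsCompleteIsometry (e i).toLinearMap)

/-- The map `A ⊗ x ↦ (A i ⊗ x)` to the `ℓ¹`-sum of the tensor products. -/
noncomputable def ell1Tensor : AlgTensor (ell1 w X) E →ₗ[ℂ] ell1 w Y :=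
  TensorProduct.lift (LinearMap.mk₂ ℂ
    (fun (A : ell1 w X) (x : E) => (⟨fun i => e i (A.1 i ⊗ₜ x), by
      refine Summable.of_nonneg_of_le (fun i => mul_nonneg (w i).coe_nonneg (vnorm_nonneg _))
        (fun i => ?_) (A.2.mul_right (vnorm x))
      -- Membership in the `ℓ¹`-sum: `‖A i ⊗ x‖ ≤ ‖A i‖ ‖x‖`, as the norm is subcross and `e i` is
      -- isometric.
      rw [mul_assoc]
      exact mul_le_mul_of_nonneg_left (((he i).vnorm_eq _).trans_le (vnorm_tmul_le _ _))
        (w i).coe_nonneg⟩ : ell1 w Y))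
    (fun A B x => Subtype.ext (funext fun i => by simp [TensorProduct.add_tmul]))
    (fun c A x => Subtype.ext (funext fun i => by simp [← TensorProduct.smul_tmul']))
    (fun A x y => Subtype.ext (funext fun i => by simp [TensorProduct.tmul_add]))
    (fun c A x => Subtype.ext (funext fun i => by simp)))

theorem ell1Tensor_tmul (A : ell1 w X) (x : E) (i : I) :
    (ell1Tensor e he (A ⊗ₜ x)).1 i = e i (A.1 i ⊗ₜ x) := rfl

/-- Fix `u` in the unit ball of `M_q(E)`. Joint complete contractivity of `φ i` on `X i ⊗ E` makes
`x ↦ (φ i (x ⊗ u a b))` a complete contraction `ψ i : X i → M_q(M_m) = M_{qm}`. So `sumMap ψ` is a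
test for the norm of `ell1 w X`, and its value at `v` is, up to reindexing, the value of the given
map at `v ⊗ u`. -/
theorem isCompleteContraction_sumMap_comp_ell1Tensor {m : ℕ}
    (φ : ∀ i, Y i →ₗ[ℂ] Matrix (Fin m) (Fin m) ℂ) (hφ : ∀ i, IsCompleteContraction (φ i)) :
    IsCompleteContraction (V := AlgTensor (ell1 w X) E)
      (sumMap (w := w) φ hφ ∘ₗ ell1Tensor e he) := by
  refine isCompleteContraction_of_kron (V := ell1 w X) (W := E) fun p q v u hv hu => ?_
  let f : Fin (q * m) ≃ Fin q × Fin m := finProdFinEquiv.symm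
  let ψ : ∀ i, X i →ₗ[ℂ] Matrix (Fin (q * m)) (Fin (q * m)) ℂ := fun i =>
    { toFun := fun x => Matrix.of fun a b =>
        φ i (e i (x ⊗ₜ u (f a).1 (f b).1)) (f a).2 (f b).2
      map_add' := fun x y => by ext; simp [TensorProduct.add_tmul]
      map_smul' := fun c x => by ext; simp [← TensorProduct.smul_tmul'] }
  have hψ : ∀ i, IsCompleteContraction (ψ i) := by
    intro i r x
    let g : Fin r × Fin (q * m) → (Fin r × Fin q) × Fin m := fun k =>
      ((k.1, (f k.2).1), (f k.2).2)
    have hg : g.Injective := by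
      rintro ⟨a, b⟩ ⟨a', b'⟩ h
      simp only [g, Prod.mk.injEq] at h ⊢
      exact ⟨h.1.1, f.injective (Prod.ext h.1.2 h.2)⟩
    have e1 : amp (ψ i) x = (ampOn (φ i ∘ₗ (e i).toLinearMap) (kron x u)).submatrix g g := rfl
    rw [e1]
    refine (opNorm_submatrix_le _ hg hg).trans
      ((((hφ i).comp_isometry (he i)).opNorm_kron_le x u).trans ?_)
    exact mul_le_of_le_one_right (apply_nonneg _ _) hu
  let g : (Fin p × Fin q) × Fin m → Fin p × Fin (q * m) := fun k => (k.1.1, f.symm (k.1.2, k.2))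
  have hg : g.Injective := by
    rintro ⟨⟨a, b⟩, c⟩ ⟨⟨a', b'⟩, c'⟩ h
    simp only [g, Prod.mk.injEq, EmbeddingLike.apply_eq_iff_eq] at h ⊢
    tauto
  have e1 : ampOn (sumMap (w := w) φ hφ ∘ₗ ell1Tensor e he) (kron v u) =
      (amp (sumMap ψ hψ) v).submatrix g g := by
    ext i j
    change ∑' k, ((w k : ℝ) : ℂ) * φ k (e k ((v i.1.1 j.1.1).1 k ⊗ₜ u i.1.2 j.1.2)) i.2 j.2 =
      ∑' k, ((w k : ℝ) : ℂ) * ψ k ((v i.1.1 j.1.1).1 k) (f.symm (i.1.2, i.2)) (f.symm (j.1.2, j.2))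
    simp [ψ]
  rw [e1]
  exact (opNorm_submatrix_le _ hg hg).trans ((opNorm_amp_sumMap_le ψ hψ v).trans hv)

/-- Every complete contraction on the tensor product is one of the tests of the `ℓ¹`-sum. The
inclusion of the `i`-th summand is bounded by `w i` at every matrix level, which the factor `(w
i)⁻¹` in `φ i` compensates. -/
theorem exists_sumMap_eq (hw : ∀ i, 0 < w i) {m : ℕ}
    {Ψ : AlgTensor (ell1 w X) E →ₗ[ℂ] Matrix (Fin m) (Fin m) ℂ}
    (hΨ : IsCompleteContraction (V := AlgTensor (ell1 w X) E) Ψ) :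
    ∃ (φ : ∀ i, Y i →ₗ[ℂ] Matrix (Fin m) (Fin m) ℂ) (hφ : ∀ i, IsCompleteContraction (φ i)),
      sumMap (w := w) φ hφ ∘ₗ ell1Tensor e he = Ψ := by
  have hw' : ∀ i, ((w i : ℝ) : ℂ) ≠ 0 := fun i => by
    have := (hw i).ne'
    exact_mod_cast this
  let φ : ∀ i, Y i →ₗ[ℂ] Matrix (Fin m) (Fin m) ℂ := fun i =>
    ((w i : ℝ) : ℂ)⁻¹ • (Ψ ∘ₗ (ell1Single w X i).rTensor E ∘ₗ (e i).symm.toLinearMap)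
  have hφ : ∀ i, IsCompleteContraction (φ i) := by
    intro i n y
    have hy : PreOperatorSpace.mnorm n (y.map (e i).symm) = PreOperatorSpace.mnorm n y := by
      rw [← he i n (y.map (e i).symm)]
      congr 1
      ext a b
      simp
    have e1 : amp (φ i) y = ((w i : ℝ) : ℂ)⁻¹ •
        amp Ψ ((y.map (e i).symm).map ((ell1Single w X i).rTensor E)) := rfl
    have hwi : 0 < (w i : ℝ) := hw i
    rw [e1, opNorm_smul, norm_inv, Complex.norm_real, Real.norm_of_nonneg hwi.le,
      inv_mul_le_iff₀ hwi, ← hy]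
    exact (hΨ _ _).trans (mnorm_map_rTensor_le hwi (fun n x => mnorm_map_ell1Single_le i x) _)
  refine ⟨φ, hφ, TensorProduct.ext' fun A x => ?_⟩
  ext a b
  -- For fixed `x`, each entry of `Ψ (A ⊗ x)` is a bounded functional of `A`, hence the sum of its
  -- values on the components of `A`.
  let L : ell1 w X →ₗ[ℂ] ℂ :=
    (Matrix.entryLinearMap ℂ ℂ a b) ∘ₗ Ψ ∘ₗ (TensorProduct.mk ℂ (ell1 w X) E).flip x
  have hL : ∀ A, ‖L A‖ ≤ vnorm x * vnorm A := fun A => by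
    refine (norm_entry_le (Ψ (A ⊗ₜ x)) a b).trans ((hΨ.opNorm_le _).trans ?_)
    rw [mul_comm]
    exact vnorm_tmul_le A x
  rw [LinearMap.comp_apply, sumMap_apply]
  refine Eq.trans (tsum_congr fun i => ?_) (hasSum_ell1Single L hL A).tsum_eq
  rw [ell1Tensor_tmul]
  simp [φ, L, mul_inv_cancel_left₀ (hw' i)]

/-- The map `ℓ¹(X i) ⊗ E → ℓ¹(X i ⊗ E)` is completely isometric. -/
theorem isCompleteIsometry_ell1Tensor (hw : ∀ i, 0 < w i) :
    IsCompleteIsometry (V := AlgTensor (ell1 w X) E) (ell1Tensor (w := w) e he) := by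
  intro n U
  refine le_antisymm (mnorm_ell1_le (apply_nonneg _ _) fun m φ hφ =>
    isCompleteContraction_sumMap_comp_ell1Tensor e he φ hφ n U) ?_
  -- By Ruan's theorem the lower bound need only be tested on complete contractions `Ψ`, and each of
  -- these factors through the `ℓ¹`-sum as some `sumMap φ`.
  refine mnorm_le_of_forall_isCompleteContraction (Z := AlgTensor (ell1 w X) E) U fun Ψ hΨ => ?_
  obtain ⟨φ, hφ, rfl⟩ := exists_sumMap_eq e he hw hΨ
  exact opNorm_amp_sumMap_le φ hφ (U.map (ell1Tensor e he))

end ell1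


/-! ### Completeness of the target and extension to the completion -/

section complete

/-- The conditions on a pre-operator space to be an operator space. -/
structure IsOperatorSpace (V : Type*) [AddCommGroup V] [Module ℂ V] [PreOperatorSpace V] :
    Prop where
  eq_zero_of_vnorm : ∀ x : V, vnorm x = 0 → x = 0
  complete : ∀ u : ℕ → V,
    (∀ ε > 0, ∃ N, ∀ m ≥ N, ∀ n ≥ N, vnorm (u m - u n) < ε) →
    ∃ x, Filter.Tendsto (fun n => vnorm (u n - x)) Filter.atTop (nhds 0)

theorem isOperatorSpace (V : Type*) [AddCommGroup V] [Module ℂ V] [OperatorSpace V] :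
    IsOperatorSpace V where
  eq_zero_of_vnorm := OperatorSpace.eq_zero_of_vnorm
  complete u hu := by
    obtain ⟨x, hx⟩ := OperatorSpace.complete u hu
    refine ⟨x, Metric.tendsto_atTop.2 fun ε hε => ?_⟩
    obtain ⟨N, hN⟩ := hx ε hε
    refine ⟨N, fun n hn => ?_⟩
    rw [Real.dist_0_eq_abs, abs_of_nonneg (vnorm_nonneg _)]
    exact hN n hn

theorem vnorm_sub_le {V : Type*} [AddCommGroup V] [Module ℂ V] [PreOperatorSpace V]
    (x y z : V) : vnorm (x - z) ≤ vnorm (x - y) + vnorm (y - z) := by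
  rw [← sub_add_sub_cancel x y z]
  exact vnorm_add_le _ _

section schatten

variable {d : ℕ} {E : Type*} [AddCommGroup E] [Module ℂ E] [PreOperatorSpace E]

/-- The index set is finite and the norm is equivalent to the sum of the entry norms, so limits are
taken entrywise and no completion of `S_d^1 ⊗ E` is needed. -/
theorem IsOperatorSpace.schatten (hE : IsOperatorSpace E) :
    IsOperatorSpace (Schatten1V d E) where
  eq_zero_of_vnorm x hx := by
    refine Matrix.ext fun i j => hE.eq_zero_of_vnorm _ (le_antisymm ?_ (vnorm_nonneg _))
    exact (vnorm_apply_le x i j).trans hx.le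
  complete u hu := by
    have h : ∀ i j, ∃ y, Filter.Tendsto (fun n => vnorm (u n i j - y)) Filter.atTop (nhds 0) := by
      intro i j
      refine hE.complete (fun n => u n i j) fun ε hε => ?_
      obtain ⟨N, hN⟩ := hu ε hε
      exact ⟨N, fun m hm n hn => (vnorm_apply_le (u m - u n) i j).trans_lt (hN m hm n hn)⟩
    choose x hx using h
    let y : Schatten1V d E := x
    refine ⟨y, squeeze_zero (fun _ => vnorm_nonneg _) (fun n => vnorm_schatten_le (u n - y)) ?_⟩
    have : (0 : ℝ) = ∑ i : Fin d, ∑ j : Fin d,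
        vnorm (Schatten1.unit i j : Schatten1 d) * 0 := by simp
    rw [this]
    exact tendsto_finsetSum _ fun i _ => tendsto_finsetSum _ fun j _ => (hx i j).const_mul _

end schatten

section ell1

variable {I : Type*} {w : I → NNReal} {X : I → Type*} [∀ i, AddCommGroup (X i)]
  [∀ i, Module ℂ (X i)] [∀ i, PreOperatorSpace (X i)]

theorem sum_le_vnorm (s : Finset I) (x : ell1 w X) :
    ∑ i ∈ s, (w i : ℝ) * vnorm (x.1 i) ≤ vnorm x := by
  rw [vnorm_ell1]
  exact x.2.sum_le_tsum s fun i _ => mul_nonneg (w i).coe_nonneg (vnorm_nonneg _)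

theorem mul_vnorm_apply_le (x : ell1 w X) (i : I) : (w i : ℝ) * vnorm (x.1 i) ≤ vnorm x := by
  simpa using sum_le_vnorm {i} x

/-- The classical argument for `ℓ¹`. Positive weights are needed for the norm to control every
coordinate. -/
theorem IsOperatorSpace.ell1 (hw : ∀ i, 0 < w i) (hX : ∀ i, IsOperatorSpace (X i)) :
    IsOperatorSpace (ell1 w X) where
  eq_zero_of_vnorm x hx := by
    refine Subtype.ext (funext fun i => (hX i).eq_zero_of_vnorm _ ?_)
    have h1 := mul_vnorm_apply_le x i
    have h2 : 0 < (w i : ℝ) := hw i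
    rw [hx] at h1
    exact le_antisymm (nonpos_of_mul_nonpos_right h1 h2) (vnorm_nonneg _)
  complete u hu := by
    have h : ∀ i, ∃ y, Filter.Tendsto (fun n => vnorm ((u n).1 i - y)) Filter.atTop (nhds 0) := by
      intro i
      refine (hX i).complete (fun n => (u n).1 i) fun ε hε => ?_
      have hwi : 0 < (w i : ℝ) := hw i
      obtain ⟨N, hN⟩ := hu (w i * ε) (mul_pos hwi hε)
      exact ⟨N, fun m hm n hn => lt_of_mul_lt_mul_left
        ((mul_vnorm_apply_le (u m - u n) i).trans_lt (hN m hm n hn)) hwi.le⟩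
    choose x hx using h
    -- Bound `∑ i ∈ s` for `u n - u m` by `ε` and let `m → ∞` with the finite set `s` fixed; `N`
    -- does not depend on `s`.
    have key : ∀ ε > 0, ∃ N, ∀ n ≥ N, ∀ s : Finset I,
        ∑ i ∈ s, (w i : ℝ) * vnorm ((u n).1 i - x i) ≤ ε := by
      intro ε hε
      obtain ⟨N, hN⟩ := hu ε hε
      refine ⟨N, fun n hn s => ?_⟩
      have ht : Filter.Tendsto (fun m => ε + ∑ i ∈ s, (w i : ℝ) * vnorm ((u m).1 i - x i))
          Filter.atTop (nhds (ε + ∑ i ∈ s, (w i : ℝ) * 0)) :=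
        (tendsto_finsetSum _ fun i _ => (hx i).const_mul _).const_add ε
      rw [Finset.sum_congr rfl fun i _ => mul_zero ((w i : ℝ)), Finset.sum_const_zero,
        add_zero] at ht
      refine ge_of_tendsto ht (Filter.eventually_atTop.2 ⟨N, fun m hm => ?_⟩)
      refine le_trans ?_ (add_le_add_left
        ((sum_le_vnorm s (u n - u m)).trans (hN n hn m hm).le) _)
      rw [← Finset.sum_add_distrib]
      refine Finset.sum_le_sum fun i _ => ?_
      rw [← mul_add]
      exact mul_le_mul_of_nonneg_left (vnorm_sub_le _ _ _) (w i).coe_nonneg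
    have h0 : ∀ n i, 0 ≤ (w i : ℝ) * vnorm ((u n).1 i - x i) := fun n i =>
      mul_nonneg (w i).coe_nonneg (vnorm_nonneg _)
    obtain ⟨N, hN⟩ := key 1 one_pos
    -- The coordinatewise limit `x` lies in the `ℓ¹`-sum since it differs from `u N` by a summable
    -- family.
    have hmem : (u N).1 - x ∈ OpSp.ell1 w X := summable_of_sum_le (h0 N) (hN N le_rfl)
    have hx' : x ∈ OpSp.ell1 w X := by
      have := (OpSp.ell1 w X).sub_mem (u N).2 hmem
      rwa [sub_sub_cancel] at this
    refine ⟨⟨x, hx'⟩, Metric.tendsto_atTop.2 fun ε hε => ?_⟩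
    obtain ⟨N, hN⟩ := key (ε / 2) (half_pos hε)
    refine ⟨N, fun n hn => ?_⟩
    rw [Real.dist_0_eq_abs, abs_of_nonneg (vnorm_nonneg _), vnorm_ell1]
    exact (Real.tsum_le_of_sum_le (h0 n) (hN n hn)).trans_lt (half_lt_self hε)

end ell1

section extension

variable {V W : Type*} [AddCommGroup V] [Module ℂ V] [PreOperatorSpace V]
  [AddCommGroup W] [Module ℂ W] [PreOperatorSpace W]

theorem IsOperatorSpace.completeSpace (hW : IsOperatorSpace W) :
    CompleteSpace (AsSeminormed W) := by
  refine Metric.complete_of_cauchySeq_tendsto fun u hu => ?_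
  obtain ⟨x, hx⟩ := hW.complete u fun ε hε => by
    obtain ⟨N, hN⟩ := Metric.cauchySeq_iff.1 hu ε hε
    refine ⟨N, fun m hm n hn => ?_⟩
    have := hN m hm n hn
    rwa [dist_eq_norm] at this
  exact ⟨x, tendsto_iff_norm_sub_tendsto_zero.2 hx⟩

theorem IsOperatorSpace.t0Space (hW : IsOperatorSpace W) : T0Space (AsSeminormed W) := by
  refine (t0Space_iff_inseparable _).2 fun x y hxy => ?_
  rw [Metric.inseparable_iff, dist_eq_norm] at hxy
  exact sub_eq_zero.1 (hW.eq_zero_of_vnorm (V := W) _ hxy)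

/-- Complete isometries into operator spaces extend to the completion. -/
theorem IsCompleteIsometry.exists_extension (hW : IsOperatorSpace W) {u : V →ₗ[ℂ] W}
    (hu : IsCompleteIsometry u) :
    ∃ J : OSCompletion V →ₗ[ℂ] W, (∀ v, J (OSCompletion.of V v) = u v) ∧
      IsCompleteIsometry J := by
  have := hW.completeSpace
  have := hW.t0Space
  let u' : AsSeminormed V →L[ℂ] AsSeminormed W :=
    LinearMap.mkContinuous (show AsSeminormed V →ₗ[ℂ] AsSeminormed W from
      { toFun := u, map_add' := u.map_add, map_smul' := u.map_smul }) 1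
      fun x => (hu.vnorm_eq x).le.trans_eq (one_mul _).symm
  let e : AsSeminormed V →L[ℂ] OSCompletion V := UniformSpace.Completion.toComplL
  let J' : OSCompletion V →L[ℂ] AsSeminormed W := u'.extend e
  have hJ' : ∀ v, J' (e v) = u' v := fun v =>
    ContinuousLinearMap.extend_eq _ UniformSpace.Completion.denseRange_coe
      (UniformSpace.Completion.isUniformInducing_coe _) v
  let J : OSCompletion V →ₗ[ℂ] W :=
    { toFun := J', map_add' := J'.map_add, map_smul' := J'.map_smul }
  refine ⟨J, hJ', fun n U => ?_⟩
  -- The two matrix norms are continuous in `U` and agree on the dense set of matrices coming from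
  -- `V`, so they agree everywhere.
  have hc : Continuous fun U : Matrix (Fin n) (Fin n) (OSCompletion V) => mnormFun n (U.map J') :=
    (uniformContinuous_mnormFun n).continuous.comp (continuous_id.matrix_map J'.continuous)
  refine (denseRange_toCompletion n).induction_on
    (p := fun U => mnormFun n (U.map J') = completionNorm n U) U
    (isClosed_eq hc (continuous_completionNorm n)) fun x => ?_
  rw [completionNorm_toCompletion]
  refine Eq.trans ?_ (hu n x)
  refine congrArg (PreOperatorSpace.mnorm (V := W) n) (Matrix.ext fun i j => ?_)
  exact hJ' (x i j)

end extension

end complete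

/-! ### The dual object: the weights are the degrees, which are positive -/

theorem DualObject.degree_pos {G : Type*} [Group G] [TopologicalSpace G] (π : DualObject G) :
    0 < π.degree :=
  Quotient.inductionOn π fun ρ => ρ.dim_pos

end OpSp

theorem mainTheorem6 {G : Type*} [Group G] [TopologicalSpace G] [IsTopologicalGroup G]
    [CompactSpace G] [T2Space G] {E : Type*} [AddCommGroup E] [Module ℂ E]
    [OpSp.OperatorSpace E] :
    ∃ J : OpSp.ProjTensor (OpSp.DualL1 G ℂ) E →ₗ[ℂ] OpSp.DualL1 G E,
      (∀ (A : OpSp.DualL1 G ℂ) (e : E) (π : OpSp.DualObject G) (i j : Fin π.degree),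
        (J (OpSp.OSCompletion.of _ (TensorProduct.tmul ℂ A e))).1 π i j = A.1 π i j • e) ∧
      OpSp.IsCompleteIsometry J := by
  have hw : ∀ π : OpSp.DualObject G, (0 : NNReal) < (π.degree : NNReal) := fun π =>
    Nat.cast_pos.2 π.degree_pos
  obtain ⟨J, hJ, hJ'⟩ := OpSp.IsCompleteIsometry.exists_extension
    (OpSp.IsOperatorSpace.ell1 hw fun π => (OpSp.isOperatorSpace E).schatten)
    (OpSp.isCompleteIsometry_ell1Tensor
      (fun π : OpSp.DualObject G => OpSp.tensorEquivSchatten π.degree E)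
      (fun π => OpSp.isCompleteIsometry_tensorEquivSchatten) hw)
  refine ⟨J, fun A e π i j => ?_, hJ'⟩
  -- On the algebraic tensor product `J` is `ell1Tensor`, whose value on `A ⊗ e` at `π` has, by
  -- definition, the entries `A π i j • e`.
  rw [hJ]
  rfl
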